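/- Let $d\ge 2$ and $0<\alpha\le\beta<\infty$. Let $a$ be a conductivity function on $\mathbb{Z}^d$, i.e. a function that assigns to every nearest-neighbour edge $[x,x+\mathbf{e}_i]$ of $\mathbb{Z}^d$ a number $a([x,x+\mathbf{e}_i])\in[\alpha,\beta]$, and put $A(x)=\mathrm{diag}\big(a([x,x+\mathbf{e}_1]),\dots,a([x,x+\mathbf{e}_d])\big)$ and $\nabla u(x)=\big(u(x+\mathbf{e}_i)-u(x)\big)_{i=1}^d$. For $T>0$ and $y\in\mathbb{Z}^d$ let $G_T(\cdot,y)=G_T(\cdot,y;a)$ be the unique function in $\ell^2(\mathbb{Z}^d)$ with $$\sum_{x\in\mathbb{Z}^d}T^{-1}G_T(x,y)v(x)+\sum_{x\in\mathbb{Z}^d}\nabla v(x)\cdot A(x)\nabla_xG_T(x,y)=v(y)\qquad\text{for all }v\in\ell^2(\mathbb{Z}^d).$$ Let $|\cdot|$ be the Euclidean norm. Then the following bounds hold, uniformly in $a$. (1) Let $d>2$. For all $k>0$ and $T_0>0$ there is a constant $C$, depending only on $d,\alpha,\beta,k,T_0$, such that for all such $a$, all $T\ge T_0$ and all $x,y\in\mathbb{Z}^d$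 $$G_T(x,y)\le C\,(1+|x-y|)^{2-d}\,\min\Big\{1,\Big(\frac{|x-y|}{\sqrt T}\Big)^{-k}\Big\},$$ where the minimum is read as $1$ if $x=y$. (2) Let $d=2$. (2a) For every $\delta\in(0,1)$ there is a constant $C$, depending only on $\alpha,\beta,\delta$, such that for all such $a$, all $T>0$ and all $x,y\in\mathbb{Z}^2$ with $1+|x-y|\le\delta\sqrt T$ $$G_T(x,y)\le C\,\ln\Big(\frac{\sqrt T}{1+|x-y|}\Big).$$ (2b) For all $k>0$, $c>0$ and $T_0>0$ there is a constant $C$, depending only on $\alpha,\beta,k,c,T_0$, such that for all such $a$, all $T\ge T_0$ and all $x,y\in\mathbb{Z}^2$ with $|x-y|\ge c\sqrt T$ $$G_T(x,y)\le C\,\Big(\frac{|x-y|}{\sqrt T}\Big)^{-k}.$$ -/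

import Mathlib

/-- A conductivity function on the nearest-neighbour edges of `ℤ^d` with values in `[α, β]`.
Every (unoriented) edge of `ℤ^d` is `[x, x + e_i]` for exactly one pair `(x, i)`, and `a x i` is
the conductivity of that edge. -/
def IsConductivity {d : ℕ} (α β : ℝ) (a : (Fin d → ℤ) → Fin d → ℝ) : Prop :=
  ∀ x i, a x i ∈ Set.Icc α β

/-- The discrete (forward) gradient, `(∇u(x))_i = u(x + e_i) - u(x)`. -/
def discreteGrad {d : ℕ} (u : (Fin d → ℤ) → ℝ) (x : Fin d → ℤ) (i : Fin d) : ℝ :=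
  u (x + Pi.single i 1) - u x

/-- `g` is an `ℓ²` solution of the weak formulation of `T⁻¹ g - ∇*·A∇g = δ_y`, where
`A(x) = diag(a(x, ·))`. -/
structure IsGreenAt {d : ℕ} (a : (Fin d → ℤ) → Fin d → ℝ) (T : ℝ) (y : Fin d → ℤ)
    (g : (Fin d → ℤ) → ℝ) : Prop where
  memℓp : Memℓp g 2
  weak : ∀ v : (Fin d → ℤ) → ℝ, Memℓp v 2 →
    ∑' x, T⁻¹ * g x * v x + ∑' x, ∑ i, discreteGrad v x i * (a x i * discreteGrad g x i) = v y

/-- The Euclidean distance `|x - y|` of two points of `ℤ^d`. -/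
noncomputable def latticeDist {d : ℕ} (x y : Fin d → ℤ) : ℝ :=
  √(∑ i, ((x i : ℝ) - (y i : ℝ)) ^ 2)

/-- `min {1, s^{-k}}` for `s ≥ 0` and `k > 0`, with the convention `0^{-k} = +∞`. -/
noncomputable def decayFactor (k s : ℝ) : ℝ :=
  if s = 0 then 1 else min 1 (s ^ (-k))

section Existence

variable {d : ℕ}

theorem memℓp_two_iff (u : (Fin d → ℤ) → ℝ) : Memℓp u 2 ↔ Summable fun x => u x ^ 2 := by
  rw [memℓp_gen_iff (by norm_num)]
  simp

theorem memℓp_shift {u : (Fin d → ℤ) → ℝ} (hu : Memℓp u 2) (e : Fin d → ℤ) :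
    Memℓp (fun x => u (x + e)) 2 := by
  rw [memℓp_two_iff] at hu ⊢
  exact hu.comp_injective (add_left_injective e)

theorem memℓp_discreteGrad {u : (Fin d → ℤ) → ℝ} (hu : Memℓp u 2) (i : Fin d) :
    Memℓp (fun x => discreteGrad u x i) 2 :=
  (memℓp_shift hu (Pi.single i 1)).sub hu

theorem memℓp_mul_bdd {u b : (Fin d → ℤ) → ℝ} (hu : Memℓp u 2) {M : ℝ}
    (hb : ∀ x, |b x| ≤ M) : Memℓp (fun x => b x * u x) 2 := by
  rw [memℓp_two_iff] at hu ⊢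
  refine Summable.of_nonneg_of_le (fun x => sq_nonneg _) (fun x => ?_) (hu.mul_left (M ^ 2))
  rw [mul_pow]
  have h := sq_le_sq' (by linarith [hb x, neg_abs_le (b x), abs_nonneg (b x)])
    ((le_abs_self _).trans (hb x))
  exact mul_le_mul_of_nonneg_right h (sq_nonneg _)

theorem lp_normSq (u : lp (fun _ : Fin d → ℤ => ℝ) 2) : ‖u‖ ^ 2 = ∑' x, u x ^ 2 := by
  rw [← real_inner_self_eq_norm_sq, lp.inner_eq_tsum]
  simp [pow_two]

/-- The `i`-th partial difference as a bounded operator on `ℓ²(ℤ^d)`. -/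
noncomputable def gradCLM (i : Fin d) :
    lp (fun _ : Fin d → ℤ => ℝ) 2 →L[ℝ] lp (fun _ : Fin d → ℤ => ℝ) 2 :=
  LinearMap.mkContinuous
    { toFun := fun u => ⟨fun x => discreteGrad u x i, memℓp_discreteGrad (lp.memℓp u) i⟩
      map_add' := fun u v => by
        ext x
        simp only [discreteGrad, lp.coeFn_add, Pi.add_apply]
        ring
      map_smul' := fun c u => by
        ext x
        simp only [discreteGrad, lp.coeFn_smul, Pi.smul_apply, smul_eq_mul, RingHom.id_apply]
        ring } 2 (fun u => by
    refine abs_le_of_sq_le_sq' ?_ (by positivity) |>.2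
    have h1 : Summable fun x => u x ^ 2 := (memℓp_two_iff _).1 (lp.memℓp u)
    have h2 : Summable fun x => u (x + Pi.single i 1) ^ 2 :=
      (memℓp_two_iff _).1 (memℓp_shift (lp.memℓp u) _)
    have h3 : Summable fun x => discreteGrad u x i ^ 2 :=
      (memℓp_two_iff _).1 (memℓp_discreteGrad (lp.memℓp u) i)
    have h4 : ∑' x, u (x + Pi.single i 1) ^ 2 = ∑' x, u x ^ 2 :=
      (Equiv.addRight (Pi.single i (1 : ℤ))).tsum_eq (fun x => u x ^ 2)
    rw [mul_pow, lp_normSq, lp_normSq]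
    calc ∑' x, discreteGrad u x i ^ 2
        ≤ ∑' x, (2 * u (x + Pi.single i 1) ^ 2 + 2 * u x ^ 2) := by
          refine h3.tsum_le_tsum (fun x => ?_) ((h2.mul_left 2).add (h1.mul_left 2))
          simp only [discreteGrad]
          nlinarith [sq_nonneg (u (x + Pi.single i 1) + u x)]
      _ = 2 ^ 2 * ∑' x, u x ^ 2 := by
          rw [(h2.mul_left 2).tsum_add (h1.mul_left 2), tsum_mul_left, tsum_mul_left, h4]
          ring)

/-- Multiplication by a bounded function, as a bounded operator on `ℓ²(ℤ^d)`. -/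
noncomputable def mulCLM (b : (Fin d → ℤ) → ℝ) (M : ℝ) (hb : ∀ x, |b x| ≤ M) :
    lp (fun _ : Fin d → ℤ => ℝ) 2 →L[ℝ] lp (fun _ : Fin d → ℤ => ℝ) 2 :=
  LinearMap.mkContinuous
    { toFun := fun u => ⟨fun x => b x * u x, memℓp_mul_bdd (lp.memℓp u) hb⟩
      map_add' := fun u v => by
        ext x
        simp only [lp.coeFn_add, Pi.add_apply]
        ring
      map_smul' := fun c u => by
        ext x
        simp only [lp.coeFn_smul, Pi.smul_apply, smul_eq_mul, RingHom.id_apply]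
        ring } M (fun u => by
    have hM : 0 ≤ M := (abs_nonneg _).trans (hb 0)
    refine abs_le_of_sq_le_sq' ?_ (by positivity) |>.2
    have h1 : Summable fun x => u x ^ 2 := (memℓp_two_iff _).1 (lp.memℓp u)
    have h3 : Summable fun x => (b x * u x) ^ 2 :=
      (memℓp_two_iff _).1 (memℓp_mul_bdd (lp.memℓp u) hb)
    rw [mul_pow, lp_normSq, lp_normSq, ← tsum_mul_left]
    refine h3.tsum_le_tsum (fun x => ?_) (h1.mul_left _)
    change (b x * u x) ^ 2 ≤ M ^ 2 * u x ^ 2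
    rw [mul_pow]
    have h := sq_le_sq' (by linarith [hb x, neg_abs_le (b x), abs_nonneg (b x)])
      ((le_abs_self _).trans (hb x))
    exact mul_le_mul_of_nonneg_right h (sq_nonneg _))

theorem abs_le_of_isConductivity {α β : ℝ} (hα : 0 < α) {a : (Fin d → ℤ) → Fin d → ℝ}
    (ha : IsConductivity α β a) (i : Fin d) (x : Fin d → ℤ) : |a x i| ≤ β := by
  rw [abs_of_nonneg (hα.le.trans (ha x i).1)]
  exact (ha x i).2

/-- The operator `T⁻¹ - ∇*·A∇` on `ℓ²(ℤ^d)`. -/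
noncomputable def massiveCLM {α β : ℝ} (hα : 0 < α) (a : (Fin d → ℤ) → Fin d → ℝ)
    (ha : IsConductivity α β a) (T : ℝ) :
    lp (fun _ : Fin d → ℤ => ℝ) 2 →L[ℝ] lp (fun _ : Fin d → ℤ => ℝ) 2 :=
  T⁻¹ • ContinuousLinearMap.id ℝ _ + ∑ i, (ContinuousLinearMap.adjoint (gradCLM i)).comp
    ((mulCLM (fun x => a x i) β (abs_le_of_isConductivity hα ha i)).comp (gradCLM i))

theorem inner_massiveCLM {α β : ℝ} (hα : 0 < α) {a : (Fin d → ℤ) → Fin d → ℝ}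
    (ha : IsConductivity α β a) (T : ℝ) (u v : lp (fun _ : Fin d → ℤ => ℝ) 2) :
    inner ℝ (massiveCLM hα a ha T u) v = ∑' x, T⁻¹ * u x * v x +
      ∑' x, ∑ i, discreteGrad v x i * (a x i * discreteGrad u x i) := by
  have key : ∀ i : Fin d, HasSum (fun x => discreteGrad v x i * (a x i * discreteGrad u x i))
      (inner ℝ (mulCLM (fun x => a x i) β (abs_le_of_isConductivity hα ha i) (gradCLM i u))
        (gradCLM i v)) := fun i => by
    exact lp.hasSum_inner (𝕜 := ℝ)
      (mulCLM (fun x => a x i) β (abs_le_of_isConductivity hα ha i) (gradCLM i u)) (gradCLM i v)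
  have h1 : ∑' x, ∑ i, discreteGrad v x i * (a x i * discreteGrad u x i) = _ :=
    (hasSum_sum fun i (_ : i ∈ Finset.univ) => key i).tsum_eq
  have h2 : ∑' x, T⁻¹ * u x * v x = T⁻¹ * inner ℝ u v := by
    rw [lp.inner_eq_tsum, ← tsum_mul_left]
    refine tsum_congr fun x => ?_
    simp only [RCLike.inner_apply, conj_trivial]
    ring
  rw [h1, h2]
  simp only [massiveCLM, add_apply, sum_apply,
    smul_apply, ContinuousLinearMap.id_apply, ContinuousLinearMap.comp_apply,
    inner_add_left, sum_inner, real_inner_smul_left, ContinuousLinearMap.adjoint_inner_left]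

theorem massive_energy_ge {α β : ℝ} (hα : 0 < α) {a : (Fin d → ℤ) → Fin d → ℝ}
    (ha : IsConductivity α β a) (T : ℝ) (u : lp (fun _ : Fin d → ℤ => ℝ) 2) :
    T⁻¹ * ‖u‖ * ‖u‖ ≤ inner ℝ (massiveCLM hα a ha T u) u := by
  rw [inner_massiveCLM, mul_assoc, ← pow_two, lp_normSq, ← tsum_mul_left]
  have h : 0 ≤ ∑' x, ∑ i, discreteGrad u x i * (a x i * discreteGrad u x i) := by
    refine tsum_nonneg fun x => Finset.sum_nonneg fun i _ => ?_
    have := hα.le.trans (ha x i).1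
    nlinarith [mul_nonneg this (mul_self_nonneg (discreteGrad u x i))]
  have h2 : ∑' x, T⁻¹ * u x ^ 2 = ∑' x, T⁻¹ * u x * u x :=
    tsum_congr fun x => by ring
  linarith

/-- For a conductivity function `a` with values in `[α, β]`, `0 < α`, and for `T > 0`, the
equation that defines `G_T(·, y; a)` has exactly one solution. -/
theorem existsUnique_isGreenAt {α β : ℝ} (hα : 0 < α) {a : (Fin d → ℤ) → Fin d → ℝ}
    (ha : IsConductivity α β a) {T : ℝ} (hT : 0 < T) (y : Fin d → ℤ) :
    ∃! g, IsGreenAt a T y g := by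
  have hco : IsCoercive ((innerSL ℝ).comp (massiveCLM hα a ha T)) :=
    ⟨T⁻¹, inv_pos.2 hT, fun u => massive_energy_ge hα ha T u⟩
  refine existsUnique_of_exists_of_unique ?_ ?_
  · let f : lp (fun _ : Fin d → ℤ => ℝ) 2 := lp.single 2 y 1
    let u := hco.continuousLinearEquivOfBilin.symm f
    refine ⟨u, lp.memℓp u, fun v hv => ?_⟩
    have h := hco.continuousLinearEquivOfBilin_apply u (⟨v, hv⟩ : lp (fun _ : Fin d → ℤ => ℝ) 2)
    have h2 : inner ℝ f (⟨v, hv⟩ : lp (fun _ : Fin d → ℤ => ℝ) 2) = v y := by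
      simp only [f, lp.inner_single_left]
      simp
    have h3 := inner_massiveCLM hα ha T u ⟨v, hv⟩
    simp only [u, ContinuousLinearEquiv.apply_symm_apply] at h
    rw [h2] at h
    exact h3.symm.trans h.symm
  · intro g g' hg hg'
    let u : lp (fun _ : Fin d → ℤ => ℝ) 2 := ⟨g, hg.memℓp⟩
    let u' : lp (fun _ : Fin d → ℤ => ℝ) 2 := ⟨g', hg'.memℓp⟩
    have e : ∀ w : lp (fun _ : Fin d → ℤ => ℝ) 2,
        inner ℝ (massiveCLM hα a ha T u) w = inner ℝ (massiveCLM hα a ha T u') w := fun w => by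
      rw [inner_massiveCLM, inner_massiveCLM]
      exact (hg.weak w (lp.memℓp w)).trans (hg'.weak w (lp.memℓp w)).symm
    have h := massive_energy_ge hα ha T (u - u')
    rw [map_sub, inner_sub_left, e, sub_self] at h
    have h0 : ‖u - u'‖ = 0 := by
      have : 0 < T⁻¹ := inv_pos.2 hT
      by_contra hne
      have hp : 0 < ‖u - u'‖ := lt_of_le_of_ne (norm_nonneg _) (Ne.symm hne)
      have := mul_pos (mul_pos this hp) hp
      linarith
    exact congrArg (fun w : lp (fun _ : Fin d → ℤ => ℝ) 2 => (w : (Fin d → ℤ) → ℝ))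
      (sub_eq_zero.1 (norm_eq_zero.1 h0))

end Existence

open Classical in
/-- The discrete Green function `G_T(x, y; a)`: for every `y`, `G_T(·, y; a)` is the unique
`ℓ²` solution of the defining equation. (The value outside the domain of definition is `0`.) -/
noncomputable def greenFunction {d : ℕ} (a : (Fin d → ℤ) → Fin d → ℝ) (T : ℝ)
    (x y : Fin d → ℤ) : ℝ :=
  if h : ∃! g, IsGreenAt a T y g then h.choose x else 0

theorem isGreenAt_greenFunction {d : ℕ} {α β : ℝ} (hα : 0 < α)
    {a : (Fin d → ℤ) → Fin d → ℝ} (ha : IsConductivity α β a) {T : ℝ} (hT : 0 < T)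
    (y : Fin d → ℤ) : IsGreenAt a T y (fun x => greenFunction a T x y) := by
  have h := existsUnique_isGreenAt hα ha hT y
  have e : (fun x => greenFunction a T x y) = h.choose := by
    funext x
    simp only [greenFunction, dif_pos h]
  rw [e]
  exact h.choose_spec.1

/-!
The Green function is summed up from the heat kernel of a lazy random walk in discrete time. With
`L = -∇*·A∇` and `Λ = 4 d β` the operator `P = 1 - L / Λ` is a symmetric Markov operator, and
`(T⁻¹ + L)⁻¹ = (T⁻¹ + Λ)⁻¹ ∑ₙ qⁿ Pⁿ` with `q = Λ / (T⁻¹ + Λ)` (`IsGreenAt.eq_sum_add`). All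
functions `uₙ = Pⁿ δ_y` have finite support, so that summation by parts is free of convergence
questions.

The heat kernel bound `|uₙ(x)| ≲ n^(-d/2) min {1, (n / (1 + |x - y|²))^p}`, for every large `p`, is
`exists_abs_walkKernel_le`. It has three ingredients:

* Nash's inequality (`tsum_sq_le_nash`), the energy balance of one step and `‖uₙ‖₁ ≤ 1` give
  `‖uₙ‖₂² ≲ n^(-d/2)` (`exists_tsum_walkKernel_sq_le`).
* For the weighted norms `W_m(n) = ∑ (1 + |z - y|²)^m uₙ(z)²` the energy balance gives
  `W_m(n + 1) ≤ W_m(n) + C W_{m-1}(n)`. Interpolating `W_{m-1}` between `W_m` and `W_0 = ‖uₙ‖₂²`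
  closes this into `W_m(n) ≲ n^(m - d/2)` for `m ≥ d`
  (`exists_tsum_distWeight_walkKernel_sq_le`).
* By reversibility, `uₙ(x)` is the `ℓ²` product of two kernels at half time started at `x` and at
  `y`, and every point is far from `x` or from `y`.

Summing over `n`, with `qⁿ` bounded by any power of `T / n`, yields the polynomial bounds
(`exists_greenFunction_le`). In two dimensions without a gain from the mass term, the times between
`|x - y|²` and `T` contribute the logarithm (`exists_greenFunction_le_log`).
-/

/-! ### The random walk among the conductances -/

/-- The operator `-∇*·A∇` in non-divergence form, for arbitrary functions on `ℤ^d`. -/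
def ellipticOp {d : ℕ} (a : (Fin d → ℤ) → Fin d → ℝ) (u : (Fin d → ℤ) → ℝ) (x : Fin d → ℤ) : ℝ :=
  ∑ i, (a (x - Pi.single i 1) i * discreteGrad u (x - Pi.single i 1) i
    - a x i * discreteGrad u x i)

/-- One step `1 - Λ⁻¹ (-∇*·A∇)` of the random walk among the conductances `a`. For
`Λ ≥ 4 d β` it is an averaging operator, and the walk stays put with probability at least `1/2`. -/
noncomputable def walkStep {d : ℕ} (a : (Fin d → ℤ) → Fin d → ℝ) (Λ : ℝ) (u : (Fin d → ℤ) → ℝ)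
    (x : Fin d → ℤ) : ℝ :=
  u x - ellipticOp a u x / Λ

/-- The `n`-step transition function of the random walk started at `y`. -/
noncomputable def walkKernel {d : ℕ} (a : (Fin d → ℤ) → Fin d → ℝ) (Λ : ℝ) (y : Fin d → ℤ)
    (n : ℕ) : (Fin d → ℤ) → ℝ :=
  (walkStep a Λ)^[n] (Pi.single y 1)

section Lattice

variable {d : ℕ}

theorem tsum_shift (f : (Fin d → ℤ) → ℝ) (e : Fin d → ℤ) : ∑' x, f (x + e) = ∑' x, f x :=
  (Equiv.addRight e).tsum_eq f

theorem summable_of_support {u f : (Fin d → ℤ) → ℝ} (hu : u.support.Finite)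
    (h : ∀ x, u x = 0 → f x = 0) : Summable f :=
  summable_of_hasFiniteSupport (hu.subset fun x hx hux => hx (h x hux))

theorem support_shift {u : (Fin d → ℤ) → ℝ} (hu : u.support.Finite) (e : Fin d → ℤ) :
    (fun x => u (x + e)).support.Finite :=
  hu.preimage (add_left_injective e).injOn

theorem support_discreteGrad {u : (Fin d → ℤ) → ℝ} (hu : u.support.Finite) (i : Fin d) :
    (fun x => discreteGrad u x i).support.Finite := by
  refine ((support_shift hu (Pi.single i 1)).union hu).subset fun x hx => ?_
  by_contra hc
  simp only [Set.mem_union, Function.mem_support, not_or, not_not] at hc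
  exact hx (by simp [discreteGrad, hc.1, hc.2])

/-- Summation by parts. -/
theorem tsum_mul_ellipticOp_of_summable {a : (Fin d → ℤ) → Fin d → ℝ} {φ u : (Fin d → ℤ) → ℝ}
    (h1 : ∀ i, Summable fun x => a x i * discreteGrad u x i * φ (x + Pi.single i 1))
    (h2 : ∀ i, Summable fun x => a x i * discreteGrad u x i * φ x) :
    ∑' x, φ x * ellipticOp a u x
      = ∑' x, ∑ i, discreteGrad φ x i * (a x i * discreteGrad u x i) := by
  have h1' : ∀ i, Summable fun x =>
      a (x - Pi.single i 1) i * discreteGrad u (x - Pi.single i 1) i * φ x := fun i => by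
    have := (Equiv.addRight (-Pi.single i (1 : ℤ) : Fin d → ℤ)).summable_iff.2 (h1 i)
    refine this.congr fun x => ?_
    simp [sub_eq_add_neg]
  have e1 : ∀ i, ∑' x, a (x - Pi.single i 1) i * discreteGrad u (x - Pi.single i 1) i * φ x
      = ∑' x, a x i * discreteGrad u x i * φ (x + Pi.single i 1) := fun i => by
    rw [← tsum_shift _ (Pi.single i 1)]
    simp
  have l : ∀ x, φ x * ellipticOp a u x = ∑ i,
      (a (x - Pi.single i 1) i * discreteGrad u (x - Pi.single i 1) i * φ x
        - a x i * discreteGrad u x i * φ x) := fun x => by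
    rw [ellipticOp, Finset.mul_sum]
    exact Finset.sum_congr rfl fun i _ => by ring
  have r : ∀ x, ∑ i, discreteGrad φ x i * (a x i * discreteGrad u x i) = ∑ i,
      (a x i * discreteGrad u x i * φ (x + Pi.single i 1) - a x i * discreteGrad u x i * φ x) :=
    fun x => Finset.sum_congr rfl fun i _ => by rw [discreteGrad]; ring
  rw [tsum_congr l, tsum_congr r, Summable.tsum_finsetSum fun i _ => (h1' i).sub (h2 i),
    Summable.tsum_finsetSum fun i _ => (h1 i).sub (h2 i)]
  refine Finset.sum_congr rfl fun i _ => ?_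
  rw [(h1' i).tsum_sub (h2 i), (h1 i).tsum_sub (h2 i), e1]

/-- Summation by parts, with a finitely supported second factor. -/
theorem tsum_mul_ellipticOp (a : (Fin d → ℤ) → Fin d → ℝ) (φ : (Fin d → ℤ) → ℝ)
    {u : (Fin d → ℤ) → ℝ} (hu : u.support.Finite) :
    ∑' x, φ x * ellipticOp a u x
      = ∑' x, ∑ i, discreteGrad φ x i * (a x i * discreteGrad u x i) :=
  tsum_mul_ellipticOp_of_summable
    (fun i => summable_of_support (support_discreteGrad hu i) fun x hx => by simp [hx])
    (fun i => summable_of_support (support_discreteGrad hu i) fun x hx => by simp [hx])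

/-- Summation by parts, with a finitely supported first factor. -/
theorem tsum_mul_ellipticOp' (a : (Fin d → ℤ) → Fin d → ℝ) {φ : (Fin d → ℤ) → ℝ}
    (hφ : φ.support.Finite) (u : (Fin d → ℤ) → ℝ) :
    ∑' x, φ x * ellipticOp a u x
      = ∑' x, ∑ i, discreteGrad φ x i * (a x i * discreteGrad u x i) :=
  tsum_mul_ellipticOp_of_summable
    (fun i => summable_of_support (support_shift hφ (Pi.single i 1)) fun x hx => by simp [hx])
    (fun i => summable_of_support hφ fun x hx => by simp [hx])

theorem support_ellipticOp (a : (Fin d → ℤ) → Fin d → ℝ) {u : (Fin d → ℤ) → ℝ}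
    (hu : u.support.Finite) : (ellipticOp a u).support.Finite := by
  refine (Set.finite_iUnion fun i => (support_shift (support_discreteGrad hu i)
    (-Pi.single i 1)).union (support_discreteGrad hu i)).subset fun x hx => ?_
  by_contra hc
  simp only [Set.mem_iUnion, Set.mem_union, Function.mem_support, not_exists, not_or,
    not_not] at hc
  refine hx (Finset.sum_eq_zero fun i _ => ?_)
  rw [sub_eq_add_neg x, (hc i).1, (hc i).2, mul_zero, mul_zero, sub_zero]

theorem support_walkStep (a : (Fin d → ℤ) → Fin d → ℝ) (Λ : ℝ) {u : (Fin d → ℤ) → ℝ}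
    (hu : u.support.Finite) : (walkStep a Λ u).support.Finite := by
  refine (hu.union (support_ellipticOp a hu)).subset fun x hx => ?_
  by_contra hc
  simp only [Set.mem_union, Function.mem_support, not_or, not_not] at hc
  exact hx (by simp [walkStep, hc.1, hc.2])

theorem support_walkStep_iterate (a : (Fin d → ℤ) → Fin d → ℝ) (Λ : ℝ) (n : ℕ)
    {u : (Fin d → ℤ) → ℝ} (hu : u.support.Finite) :
    ((walkStep a Λ)^[n] u).support.Finite := by
  induction n with
  | zero => exact hu
  | succ n ih =>
    rw [Function.iterate_succ_apply']
    exact support_walkStep a Λ ih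

theorem support_single (y : Fin d → ℤ) :
    (Pi.single y (1 : ℝ) : (Fin d → ℤ) → ℝ).support.Finite :=
  (Set.finite_singleton y).subset Pi.support_single_subset

theorem support_walkKernel (a : (Fin d → ℤ) → Fin d → ℝ) (Λ : ℝ) (y : Fin d → ℤ) (n : ℕ) :
    (walkKernel a Λ y n).support.Finite :=
  support_walkStep_iterate a Λ n (support_single y)

theorem walkKernel_zero (a : (Fin d → ℤ) → Fin d → ℝ) (Λ : ℝ) (y : Fin d → ℤ) :
    walkKernel a Λ y 0 = Pi.single y 1 := rfl

theorem walkKernel_succ (a : (Fin d → ℤ) → Fin d → ℝ) (Λ : ℝ) (y : Fin d → ℤ) (n : ℕ) :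
    walkKernel a Λ y (n + 1) = walkStep a Λ (walkKernel a Λ y n) :=
  Function.iterate_succ_apply' _ _ _

/-- The walk is reversible with respect to the counting measure. -/
theorem tsum_mul_walkStep (a : (Fin d → ℤ) → Fin d → ℝ) (Λ : ℝ) {u v : (Fin d → ℤ) → ℝ}
    (hu : u.support.Finite) (hv : v.support.Finite) :
    ∑' x, u x * walkStep a Λ v x = ∑' x, walkStep a Λ u x * v x := by
  have h : ∑' x, u x * ellipticOp a v x = ∑' x, v x * ellipticOp a u x := by
    rw [tsum_mul_ellipticOp a u hv, tsum_mul_ellipticOp a v hu]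
    exact tsum_congr fun x => Finset.sum_congr rfl fun i _ => by ring
  have e1 : ∀ x, u x * walkStep a Λ v x = u x * v x - (u x * ellipticOp a v x) / Λ := fun x => by
    rw [walkStep]; ring
  have e2 : ∀ x, walkStep a Λ u x * v x = u x * v x - (v x * ellipticOp a u x) / Λ := fun x => by
    rw [walkStep]; ring
  have s0 : Summable fun x => u x * v x := summable_of_support hu fun x hx => by simp [hx]
  rw [tsum_congr e1, tsum_congr e2, s0.tsum_sub, s0.tsum_sub, tsum_div_const, tsum_div_const, h]
  · exact summable_of_support hv fun x hx => by simp [hx]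
  · exact summable_of_support hu fun x hx => by simp [hx]

theorem tsum_mul_walkStep_iterate (a : (Fin d → ℤ) → Fin d → ℝ) (Λ : ℝ) (n : ℕ)
    {u v : (Fin d → ℤ) → ℝ} (hu : u.support.Finite) (hv : v.support.Finite) :
    ∑' x, u x * (walkStep a Λ)^[n] v x = ∑' x, (walkStep a Λ)^[n] u x * v x := by
  induction n generalizing u with
  | zero => rfl
  | succ n ih =>
    rw [Function.iterate_succ_apply', Function.iterate_succ_apply, ← ih (support_walkStep a Λ hu)]
    exact tsum_mul_walkStep a Λ hu (support_walkStep_iterate a Λ n hv)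

/-- The Chapman–Kolmogorov identity, with the second factor started at the end point. -/
theorem walkKernel_add (a : (Fin d → ℤ) → Fin d → ℝ) (Λ : ℝ) (x y : Fin d → ℤ) (n l : ℕ) :
    walkKernel a Λ y (n + l) x = ∑' z, walkKernel a Λ y n z * walkKernel a Λ x l z := by
  have h := tsum_mul_walkStep_iterate a Λ l (support_walkKernel a Λ y n) (support_single x)
  rw [walkKernel.eq_1 a Λ x l, h, walkKernel, walkKernel, ← Function.iterate_add_apply,
    add_comm l n, tsum_eq_single x (fun z hz => by simp [hz])]
  simp

variable {α β Λ : ℝ} {a : (Fin d → ℤ) → Fin d → ℝ}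

theorem walkStep_eq (a : (Fin d → ℤ) → Fin d → ℝ) (Λ : ℝ) (u : (Fin d → ℤ) → ℝ)
    (x : Fin d → ℤ) :
    walkStep a Λ u x = u x + (∑ i, (a (x - Pi.single i 1) i * (u (x - Pi.single i 1) - u x)
      + a x i * (u (x + Pi.single i 1) - u x))) / Λ := by
  rw [walkStep, ellipticOp, sub_eq_add_neg, ← neg_div, ← Finset.sum_neg_distrib]
  congr 2
  refine Finset.sum_congr rfl fun i _ => ?_
  simp only [discreteGrad, sub_add_cancel]
  ring

theorem sum_conductivity_le (ha : IsConductivity α β a) (hΛ : 4 * d * β ≤ Λ)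
    (x : Fin d → ℤ) : ∑ i, (a (x - Pi.single i 1) i + a x i) ≤ Λ / 2 := by
  calc ∑ i, (a (x - Pi.single i 1) i + a x i) ≤ ∑ _i : Fin d, 2 * β :=
        Finset.sum_le_sum fun i _ => by linarith [(ha x i).2, (ha (x - Pi.single i 1) i).2]
    _ ≤ Λ / 2 := by simp; linarith

/-- The step is positivity preserving, since `Λ` is at least twice the total conductance at each
vertex. -/
theorem abs_walkStep_le (hα : 0 < α) (ha : IsConductivity α β a) (hΛ0 : 0 < Λ)
    (hΛ : 4 * d * β ≤ Λ) (u : (Fin d → ℤ) → ℝ) (x : Fin d → ℤ) :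
    |walkStep a Λ u x| ≤ walkStep a Λ (fun z => |u z|) x := by
  have key : ∀ v : (Fin d → ℤ) → ℝ, (∀ z, v z ≤ |u z|) →
      walkStep a Λ v x ≤ walkStep a Λ (fun z => |u z|) x := fun v hv => by
    have hs := sum_conductivity_le ha hΛ x
    have hsum : (∑ i, (a (x - Pi.single i 1) i * (v (x - Pi.single i 1) - v x)
        + a x i * (v (x + Pi.single i 1) - v x)))
        ≤ (∑ i, (a (x - Pi.single i 1) i * (|u (x - Pi.single i 1)| - |u x|)
        + a x i * (|u (x + Pi.single i 1)| - |u x|)))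
        + (∑ i, (a (x - Pi.single i 1) i + a x i)) * (|u x| - v x) := by
      rw [Finset.sum_mul, ← Finset.sum_add_distrib]
      refine Finset.sum_le_sum fun i _ => ?_
      have h1 := mul_le_mul_of_nonneg_left (hv (x - Pi.single i 1))
        (hα.le.trans (ha (x - Pi.single i 1) i).1)
      have h2 := mul_le_mul_of_nonneg_left (hv (x + Pi.single i 1)) (hα.le.trans (ha x i).1)
      linarith
    have h3 := mul_le_mul_of_nonneg_right hs (sub_nonneg.2 (hv x))
    have h4 := mul_nonneg hΛ0.le (sub_nonneg.2 (hv x))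
    rw [walkStep_eq, walkStep_eq, ← sub_nonneg]
    have : 0 ≤ (Λ * (|u x| - v x) + ((∑ i, (a (x - Pi.single i 1) i *
        (|u (x - Pi.single i 1)| - |u x|) + a x i * (|u (x + Pi.single i 1)| - |u x|)))
        - (∑ i, (a (x - Pi.single i 1) i * (v (x - Pi.single i 1) - v x)
        + a x i * (v (x + Pi.single i 1) - v x))))) / Λ := div_nonneg (by linarith) hΛ0.le
    convert this using 1
    field_simp
    ring
  refine abs_le.2 ⟨?_, key u fun z => le_abs_self _⟩
  have h := key (fun z => -u z) fun z => neg_le_abs _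
  have e : walkStep a Λ (fun z => -u z) x = -walkStep a Λ u x := by
    rw [walkStep_eq, walkStep_eq, neg_add, ← neg_div, ← Finset.sum_neg_distrib]
    congr 2
    exact Finset.sum_congr rfl fun i _ => by ring
  linarith

theorem abs_walkStep_le_of_abs_le (hα : 0 < α) (ha : IsConductivity α β a) (hΛ0 : 0 < Λ)
    (hΛ : 4 * d * β ≤ Λ) {u : (Fin d → ℤ) → ℝ} {B : ℝ} (hu : ∀ x, |u x| ≤ B) (x : Fin d → ℤ) :
    |walkStep a Λ u x| ≤ B := by
  refine (abs_walkStep_le hα ha hΛ0 hΛ u x).trans ?_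
  have hs := sum_conductivity_le ha hΛ x
  have hsum : (∑ i, (a (x - Pi.single i 1) i * (|u (x - Pi.single i 1)| - |u x|)
      + a x i * (|u (x + Pi.single i 1)| - |u x|)))
      ≤ (∑ i, (a (x - Pi.single i 1) i + a x i)) * (B - |u x|) := by
    rw [Finset.sum_mul]
    refine Finset.sum_le_sum fun i _ => ?_
    have h1 := mul_le_mul_of_nonneg_left (hu (x - Pi.single i 1))
      (hα.le.trans (ha (x - Pi.single i 1) i).1)
    have h2 := mul_le_mul_of_nonneg_left (hu (x + Pi.single i 1)) (hα.le.trans (ha x i).1)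
    linarith
  have h3 := mul_le_mul_of_nonneg_right hs (sub_nonneg.2 (hu x))
  have h4 := mul_nonneg hΛ0.le (sub_nonneg.2 (hu x))
  rw [walkStep_eq]
  have h5 := (div_le_iff₀ hΛ0 (b := ∑ i, (a (x - Pi.single i 1) i *
    (|u (x - Pi.single i 1)| - |u x|) + a x i * (|u (x + Pi.single i 1)| - |u x|)))
    (a := B - |u x|)).2 (by linarith)
  linarith

/-- The step contracts the `ℓ¹` norm, by positivity and conservation of mass. -/
theorem tsum_abs_walkStep_le (hα : 0 < α) (ha : IsConductivity α β a) (hΛ0 : 0 < Λ)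
    (hΛ : 4 * d * β ≤ Λ) {u : (Fin d → ℤ) → ℝ} (hu : u.support.Finite) :
    ∑' x, |walkStep a Λ u x| ≤ ∑' x, |u x| := by
  have hu' : (fun z => |u z|).support.Finite := by simpa [Function.support] using hu
  have h0 : ∑' x, ellipticOp a (fun z => |u z|) x = 0 := by
    have h := tsum_mul_ellipticOp a (fun _ => 1) hu'
    simpa [discreteGrad] using h
  calc ∑' x, |walkStep a Λ u x| ≤ ∑' x, walkStep a Λ (fun z => |u z|) x :=
        Summable.tsum_le_tsum (abs_walkStep_le hα ha hΛ0 hΛ u)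
          (summable_of_support (support_walkStep a Λ hu) fun x hx => by simp [hx])
          (summable_of_support (support_walkStep a Λ hu') fun x hx => hx)
    _ = ∑' x, |u x| := by
      simp only [walkStep]
      rw [Summable.tsum_sub (summable_of_support hu' fun x hx => hx)
        (summable_of_support (support_ellipticOp a hu') fun x hx => by simp [hx]),
        tsum_div_const, h0, zero_div, sub_zero]

theorem tsum_abs_walkKernel_le (hα : 0 < α) (ha : IsConductivity α β a) (hΛ0 : 0 < Λ)
    (hΛ : 4 * d * β ≤ Λ) (y : Fin d → ℤ) (n : ℕ) : ∑' x, |walkKernel a Λ y n x| ≤ 1 := by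
  induction n with
  | zero =>
    rw [walkKernel_zero, tsum_eq_single y (fun z hz => by simp [hz])]
    simp
  | succ n ih =>
    rw [walkKernel_succ]
    exact (tsum_abs_walkStep_le hα ha hΛ0 hΛ (support_walkKernel a Λ y n)).trans ih

theorem ellipticOp_sq_le (hα : 0 < α) (ha : IsConductivity α β a)
    (hΛ : 4 * d * β ≤ Λ) (u : (Fin d → ℤ) → ℝ) (x : Fin d → ℤ) :
    ellipticOp a u x ^ 2 ≤ Λ / 2 * ∑ i,
      (a (x - Pi.single i 1) i * discreteGrad u (x - Pi.single i 1) i ^ 2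
        + a x i * discreteGrad u x i ^ 2) := by
  have hs := sum_conductivity_le ha hΛ x
  have hpos : ∀ z i, 0 ≤ a z i := fun z i => hα.le.trans (ha z i).1
  have hn : 0 ≤ ∑ i, (a (x - Pi.single i 1) i * discreteGrad u (x - Pi.single i 1) i ^ 2
        + a x i * discreteGrad u x i ^ 2) :=
    Finset.sum_nonneg fun i _ => add_nonneg (mul_nonneg (hpos _ _) (sq_nonneg _))
      (mul_nonneg (hpos _ _) (sq_nonneg _))
  refine le_trans ?_ (mul_le_mul_of_nonneg_right hs hn)
  rw [ellipticOp]
  refine Finset.sum_sq_le_sum_mul_sum_of_sq_le_mul _ (fun i _ => add_nonneg (hpos _ _) (hpos _ _))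
    (fun i _ => add_nonneg (mul_nonneg (hpos _ _) (sq_nonneg _))
      (mul_nonneg (hpos _ _) (sq_nonneg _))) fun i _ => ?_
  nlinarith [mul_nonneg (mul_nonneg (hpos (x - Pi.single i 1) i) (hpos x i))
    (sq_nonneg (discreteGrad u (x - Pi.single i 1) i + discreteGrad u x i))]

/-- The energy balance of one step in a weighted `ℓ²` norm. Laziness of the walk bounds the
second order term `Λ⁻² (∇*·A∇u)²` by half of the dissipation. -/
theorem tsum_weight_walkStep_sq_le (hα : 0 < α) (ha : IsConductivity α β a) (hΛ0 : 0 < Λ)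
    (hΛ : 4 * d * β ≤ Λ) {w u : (Fin d → ℤ) → ℝ} (hw : ∀ x, 0 ≤ w x) (hu : u.support.Finite) :
    ∑' x, w x * walkStep a Λ u x ^ 2 ≤ ∑' x, w x * u x ^ 2 + Λ⁻¹ * ∑' x, ∑ i,
      a x i * (-(1 / 2) * (w x + w (x + Pi.single i 1)) * discreteGrad u x i ^ 2
        - discreteGrad w x i * (u x + u (x + Pi.single i 1)) * discreteGrad u x i) := by
  have hg := support_discreteGrad hu
  have sg : ∀ f : (Fin d → ℤ) → Fin d → ℝ, (∀ x i, discreteGrad u x i = 0 → f x i = 0) →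
      Summable fun x => ∑ i, f x i := fun f hf =>
    summable_sum fun i _ => summable_of_support (hg i) fun x => hf x i
  have sL : ∀ f : (Fin d → ℤ) → ℝ, (∀ x, ellipticOp a u x = 0 → f x = 0) → Summable f :=
    fun f hf => summable_of_support (support_ellipticOp a hu) hf
  have s1 : Summable fun x => w x * u x ^ 2 := summable_of_support hu fun x hx => by simp [hx]
  have s2 : Summable fun x => w x * u x * ellipticOp a u x := sL _ fun x hx => by simp [hx]
  have s3 : Summable fun x => w x * ellipticOp a u x ^ 2 := sL _ fun x hx => by simp [hx]
  have e : ∑' x, w x * walkStep a Λ u x ^ 2 = ∑' x, w x * u x ^ 2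
      - 2 * Λ⁻¹ * ∑' x, w x * u x * ellipticOp a u x
      + Λ⁻¹ ^ 2 * ∑' x, w x * ellipticOp a u x ^ 2 := by
    rw [← tsum_mul_left, ← tsum_mul_left, ← s1.tsum_sub (s2.mul_left _),
      ← (s1.sub (s2.mul_left _)).tsum_add (s3.mul_left _)]
    exact tsum_congr fun x => by rw [walkStep]; ring
  have e2 := tsum_mul_ellipticOp a (fun x => w x * u x) hu
  have e3 : ∑' x, w x * ellipticOp a u x ^ 2 ≤ Λ / 2 * ∑' x, ∑ i,
      a x i * ((w x + w (x + Pi.single i 1)) * discreteGrad u x i ^ 2) := by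
    have sA : ∀ i, Summable fun x => w x * (a x i * discreteGrad u x i ^ 2) := fun i =>
      summable_of_support (hg i) fun x hx => by simp [hx]
    have sB : ∀ i, Summable fun x =>
        w (x + Pi.single i 1) * (a x i * discreteGrad u x i ^ 2) := fun i =>
      summable_of_support (hg i) fun x hx => by simp [hx]
    have sC : ∀ i, Summable fun x => w x * (a (x - Pi.single i 1) i *
        discreteGrad u (x - Pi.single i 1) i ^ 2) := fun i => by
      refine summable_of_support (support_shift (hg i) (-Pi.single i 1)) fun x hx => ?_
      rw [sub_eq_add_neg x, hx]
      simp
    have eC : ∀ i, ∑' x, w x * (a (x - Pi.single i 1) i *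
        discreteGrad u (x - Pi.single i 1) i ^ 2) =
        ∑' x, w (x + Pi.single i 1) * (a x i * discreteGrad u x i ^ 2) := fun i => by
      rw [← tsum_shift _ (Pi.single i 1)]
      simp
    calc ∑' x, w x * ellipticOp a u x ^ 2
        ≤ ∑' x, Λ / 2 * ∑ i, (w x * (a (x - Pi.single i 1) i *
            discreteGrad u (x - Pi.single i 1) i ^ 2)
            + w x * (a x i * discreteGrad u x i ^ 2)) := by
          refine s3.tsum_le_tsum (fun x => ?_)
            ((summable_sum fun i _ => (sC i).add (sA i)).mul_left _)
          have h := mul_le_mul_of_nonneg_left (ellipticOp_sq_le hα ha hΛ u x) (hw x)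
          simp only [← mul_add]
          rw [← Finset.mul_sum]
          linarith
      _ = Λ / 2 * ∑' x, ∑ i,
          a x i * ((w x + w (x + Pi.single i 1)) * discreteGrad u x i ^ 2) := by
        rw [tsum_mul_left, Summable.tsum_finsetSum fun i _ => (sC i).add (sA i),
          Summable.tsum_finsetSum fun i _ =>
            summable_of_support (hg i) fun x hx => by simp [hx]]
        congr 1
        refine Finset.sum_congr rfl fun i _ => ?_
        rw [(sC i).tsum_add (sA i), eC, ← (sB i).tsum_add (sA i)]
        exact tsum_congr fun x => by ring
  have e4 : ∑' x, ∑ i, a x i * (-(1 / 2) * (w x + w (x + Pi.single i 1)) * discreteGrad u x i ^ 2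
        - discreteGrad w x i * (u x + u (x + Pi.single i 1)) * discreteGrad u x i)
      = 1 / 2 * (∑' x, ∑ i, a x i * ((w x + w (x + Pi.single i 1)) * discreteGrad u x i ^ 2))
      - 2 * ∑' x, ∑ i, discreteGrad (fun x => w x * u x) x i * (a x i * discreteGrad u x i) := by
    rw [← tsum_mul_left, ← tsum_mul_left, ← Summable.tsum_sub]
    · refine tsum_congr fun x => ?_
      rw [Finset.mul_sum, Finset.mul_sum, ← Finset.sum_sub_distrib]
      refine Finset.sum_congr rfl fun i _ => ?_
      simp only [discreteGrad]
      ring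
    · exact (sg _ fun x i hx => by simp [hx]).mul_left _
    · exact (sg _ fun x i hx => by simp [hx]).mul_left _
  have h := mul_le_mul_of_nonneg_left e3 (sq_nonneg Λ⁻¹)
  have hc : Λ⁻¹ ^ 2 * (Λ / 2 * ∑' x, ∑ i,
      a x i * ((w x + w (x + Pi.single i 1)) * discreteGrad u x i ^ 2)) = Λ⁻¹ * (1 / 2 * ∑' x, ∑ i,
      a x i * ((w x + w (x + Pi.single i 1)) * discreteGrad u x i ^ 2)) := by
    field_simp
  rw [e, e2, e4, mul_sub]
  linarith

end Lattice

/-! ### Nash's inequality -/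

section Nash

variable {d : ℕ}

/-- Moving `u` by a vector of the cube `[0, r)^d` changes it by `O(r ‖∇u‖)` in `ℓ²`: the norm of
the change is subadditive in the vector. -/
theorem tsum_shift_sub_sq_le {u : (Fin d → ℤ) → ℝ} (hu : u.support.Finite) (r : ℕ)
    (z : Fin d → Fin r) :
    ∑' x, (u (x + fun i => ((z i : ℕ) : ℤ)) - u x) ^ 2
      ≤ d * r ^ 2 * ∑' x, ∑ i, discreteGrad u x i ^ 2 := by
  have hu2 : Memℓp u 2 := (memℓp_two_iff u).2 (summable_of_support hu fun x hx => by simp [hx])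
  let U : lp (fun _ : Fin d → ℤ => ℝ) 2 := ⟨u, hu2⟩
  let D : (Fin d → ℤ) → lp (fun _ : Fin d → ℤ => ℝ) 2 := fun e => ⟨_, memℓp_shift hu2 e⟩ - U
  have hD : ∀ e, ‖D e‖ ^ 2 = ∑' x, (u (x + e) - u x) ^ 2 := fun e => lp_normSq _
  have hadd : ∀ e e', ‖D (e + e')‖ ≤ ‖D e‖ + ‖D e'‖ := fun e e' => by
    let V : lp (fun _ : Fin d → ℤ => ℝ) 2 := ⟨_, memℓp_shift (lp.memℓp (D e')) e⟩
    have h1 : D (e + e') = V + D e := by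
      ext x
      change u (x + (e + e')) - u x = (u (x + e + e') - u (x + e)) + (u (x + e) - u x)
      rw [add_assoc]
      ring
    have h2 : ‖V‖ ^ 2 = ‖D e'‖ ^ 2 := by
      rw [hD, lp_normSq, ← tsum_shift (fun x => (u (x + e') - u x) ^ 2) e]
      rfl
    have h3 : ‖V‖ = ‖D e'‖ := by
      rwa [sq_eq_sq₀ (norm_nonneg _) (norm_nonneg _)] at h2
    rw [h1, add_comm ‖D e‖, ← h3]
    exact norm_add_le _ _
  have hzero : ‖D 0‖ = 0 := by
    have h : D 0 = 0 := by
      ext x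
      change u (x + 0) - u x = 0
      rw [add_zero, sub_self]
    rw [h, norm_zero]
  have hmul : ∀ (i : Fin d) (n : ℕ), ‖D (Pi.single i (n : ℤ))‖ ≤ n * ‖D (Pi.single i 1)‖ :=
    fun i n => by
      induction n with
      | zero => simp [hzero]
      | succ n ih =>
        push_cast
        rw [Pi.single_add]
        linarith [hadd (Pi.single i (n : ℤ)) (Pi.single i 1)]
  have hz : (fun i => ((z i : ℕ) : ℤ)) = ∑ i, Pi.single i ((z i : ℕ) : ℤ) :=
    (Finset.univ_sum_single _).symm
  have h1 : ‖D fun i => ((z i : ℕ) : ℤ)‖ ≤ r * ∑ i, ‖D (Pi.single i 1)‖ := by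
    rw [hz, Finset.mul_sum]
    refine (Finset.le_sum_of_subadditive (fun e => ‖D e‖) hzero.le hadd _ _).trans
      (Finset.sum_le_sum fun i _ => (hmul i _).trans ?_)
    have : ((z i : ℕ) : ℝ) ≤ r := by exact_mod_cast (z i).2.le
    gcongr
  have h2 : (∑ i, ‖D (Pi.single i 1)‖) ^ 2 ≤ d * ∑ i, ‖D (Pi.single i 1)‖ ^ 2 := by
    simpa using sq_sum_le_card_mul_sum_sq (s := Finset.univ)
      (f := fun i : Fin d => ‖D (Pi.single i 1)‖)
  have h3 : ∑ i, ‖D (Pi.single i 1)‖ ^ 2 = ∑' x, ∑ i, discreteGrad u x i ^ 2 := by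
    rw [Summable.tsum_finsetSum fun i _ =>
      summable_of_support (support_discreteGrad hu i) fun x hx => by simp [hx]]
    exact Finset.sum_congr rfl fun i _ => hD _
  calc ∑' x, (u (x + fun i => ((z i : ℕ) : ℤ)) - u x) ^ 2
      = ‖D fun i => ((z i : ℕ) : ℤ)‖ ^ 2 := (hD _).symm
    _ ≤ (r * ∑ i, ‖D (Pi.single i 1)‖) ^ 2 := by gcongr
    _ = r ^ 2 * (∑ i, ‖D (Pi.single i 1)‖) ^ 2 := by ring
    _ ≤ r ^ 2 * (d * ∑ i, ‖D (Pi.single i 1)‖ ^ 2) := by gcongr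
    _ = _ := by rw [h3]; ring

/-- Nash's inequality on `ℤ^d`, with the optimization over the scale `r` left open. It comes from
comparing `u` with its averages over the translates of the cube `[0, r)^d`. -/
theorem tsum_sq_le_nash {u : (Fin d → ℤ) → ℝ} (hu : u.support.Finite) {r : ℕ} (hr : 0 < r) :
    ∑' x, u x ^ 2 ≤ 2 * (d * r ^ 2 * ∑' x, ∑ i, discreteGrad u x i ^ 2)
      + 2 * ((∑' x, |u x|) ^ 2 / r ^ d) := by
  let ι : (Fin d → Fin r) → Fin d → ℤ := fun z i => ((z i : ℕ) : ℤ)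
  have hι : Function.Injective ι := fun z z' h => by
    funext i
    have := congrFun h i
    exact Fin.ext (Int.ofNat_inj.1 this)
  have hrd : (0 : ℝ) < r ^ d := by positivity
  have hcard : (Finset.univ : Finset (Fin d → Fin r)).card = r ^ d := by simp
  -- the average over a cube
  let m : (Fin d → ℤ) → ℝ := fun x => (∑ z, u (x + ι z)) / r ^ d
  have hsh : ∀ z, (fun x => u (x + ι z)).support.Finite := fun z => support_shift hu _
  have hm : m.support.Finite := by
    refine (Set.finite_iUnion hsh).subset fun x hx => ?_
    by_contra hc
    simp only [Set.mem_iUnion, Function.mem_support, not_exists, not_not] at hc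
    exact hx (by simp [m, hc])
  have sabs : Summable fun x => |u x| := summable_of_support hu fun x hx => by simp [hx]
  have hL : 0 ≤ ∑' x, |u x| := tsum_nonneg fun x => abs_nonneg _
  have hm1 : ∀ x, |m x| ≤ (∑' x, |u x|) / r ^ d := fun x => by
    rw [abs_div, abs_of_pos hrd]
    gcongr
    refine (Finset.abs_sum_le_sum_abs _ _).trans ?_
    have h := sabs.sum_le_tsum (Finset.univ.map ⟨fun z => x + ι z, fun z z' h =>
      hι (add_left_cancel h)⟩) (fun i _ => abs_nonneg _)
    rwa [Finset.sum_map] at h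
  have hm2 : ∑' x, |m x| ≤ ∑' x, |u x| := by
    have s : ∀ z, Summable fun x => |u (x + ι z)| := fun z =>
      summable_of_support (hsh z) fun x hx => by simp [hx]
    calc ∑' x, |m x| ≤ ∑' x, (∑ z, |u (x + ι z)|) / r ^ d := by
          refine Summable.tsum_le_tsum (fun x => ?_)
            (summable_of_support hm fun x hx => by simp [hx])
            ((summable_sum fun z _ => s z).div_const _)
          rw [abs_div, abs_of_pos hrd]
          gcongr
          exact Finset.abs_sum_le_sum_abs _ _
      _ = ∑' x, |u x| := by
          rw [tsum_div_const, Summable.tsum_finsetSum fun z _ => s z]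
          have : ∀ z, ∑' x, |u (x + ι z)| = ∑' x, |u x| := fun z =>
            tsum_shift (fun x => |u x|) _
          simp only [this, Finset.sum_const, hcard, nsmul_eq_mul]
          push_cast
          field_simp
  have hmm : ∑' x, m x ^ 2 ≤ (∑' x, |u x|) ^ 2 / r ^ d := by
    calc ∑' x, m x ^ 2 ≤ ∑' x, (∑' x, |u x|) / r ^ d * |m x| := by
          refine Summable.tsum_le_tsum (fun x => ?_)
            (summable_of_support hm fun x hx => by simp [hx])
            (summable_of_support hm fun x hx => by simp [hx])
          rw [← sq_abs, sq]
          exact mul_le_mul_of_nonneg_right (hm1 x) (abs_nonneg _)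
      _ ≤ (∑' x, |u x|) / r ^ d * ∑' x, |u x| := by
          rw [tsum_mul_left]
          gcongr
      _ = _ := by ring
  have hsub : ∀ {v : (Fin d → ℤ) → ℝ}, v.support.Finite →
      (fun x => v x - u x).support.Finite := fun {v} hv => by
    refine (hv.union hu).subset fun x hx => ?_
    by_contra hc
    simp only [Set.mem_union, Function.mem_support, not_or, not_not] at hc
    exact hx (by simp [hc.1, hc.2])
  have hum : ∑' x, (m x - u x) ^ 2 ≤ d * r ^ 2 * ∑' x, ∑ i, discreteGrad u x i ^ 2 := by
    have s : ∀ z, Summable fun x => (u (x + ι z) - u x) ^ 2 := fun z =>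
      summable_of_support (hsub (hsh z)) fun x hx => by simp [hx]
    calc ∑' x, (m x - u x) ^ 2 ≤ ∑' x, (∑ z, (u (x + ι z) - u x) ^ 2) / r ^ d := by
          refine Summable.tsum_le_tsum (fun x => ?_)
            (summable_of_support (hsub hm) fun x hx => by simp [hx])
            ((summable_sum fun z _ => s z).div_const _)
          have h := sq_sum_le_card_mul_sum_sq (s := Finset.univ)
            (f := fun z : Fin d → Fin r => u (x + ι z) - u x)
          have e : m x - u x = (∑ z, (u (x + ι z) - u x)) / r ^ d := by
            rw [Finset.sum_sub_distrib, Finset.sum_const, hcard, nsmul_eq_mul]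
            simp only [m]
            push_cast
            field_simp
          rw [hcard] at h
          push_cast at h
          rw [e, div_pow, div_le_div_iff₀ (by positivity) hrd]
          calc _ ≤ (r ^ d * ∑ z, (u (x + ι z) - u x) ^ 2) * (r : ℝ) ^ d := by gcongr
            _ = _ := by ring
      _ = (∑ z, ∑' x, (u (x + ι z) - u x) ^ 2) / r ^ d := by
          rw [tsum_div_const, Summable.tsum_finsetSum fun z _ => s z]
      _ ≤ (∑ _z : Fin d → Fin r, d * r ^ 2 * ∑' x, ∑ i, discreteGrad u x i ^ 2) / r ^ d := by
          gcongr with z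
          exact tsum_shift_sub_sq_le hu r z
      _ = _ := by
          rw [Finset.sum_const, hcard, nsmul_eq_mul]
          push_cast
          field_simp
  have s1 : Summable fun x => 2 * (m x - u x) ^ 2 :=
    summable_of_support (hsub hm) fun x hx => by simp [hx]
  have s2 : Summable fun x => 2 * m x ^ 2 := summable_of_support hm fun x hx => by simp [hx]
  calc ∑' x, u x ^ 2 ≤ ∑' x, (2 * (m x - u x) ^ 2 + 2 * m x ^ 2) := by
        refine Summable.tsum_le_tsum (fun x => ?_)
          (summable_of_support hu fun x hx => by simp [hx]) (s1.add s2)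
        nlinarith [sq_nonneg (2 * m x - u x)]
    _ = 2 * ∑' x, (m x - u x) ^ 2 + 2 * ∑' x, m x ^ 2 := by
        rw [s1.tsum_add s2, tsum_mul_left, tsum_mul_left]
    _ ≤ _ := by gcongr

end Nash

/-! ### Decay of the heat kernel in `ℓ²` -/

section Decay

variable {d : ℕ} {α β Λ : ℝ}

/-- The unweighted energy balance: one step loses a multiple of the Dirichlet energy. -/
theorem tsum_walkStep_sq_le {a : (Fin d → ℤ) → Fin d → ℝ} (hα : 0 < α)
    (ha : IsConductivity α β a) (hΛ0 : 0 < Λ) (hΛ : 4 * d * β ≤ Λ) {u : (Fin d → ℤ) → ℝ}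
    (hu : u.support.Finite) :
    ∑' x, walkStep a Λ u x ^ 2
      ≤ ∑' x, u x ^ 2 - α / Λ * ∑' x, ∑ i, discreteGrad u x i ^ 2 := by
  have h := tsum_weight_walkStep_sq_le hα ha hΛ0 hΛ (w := fun _ => 1) (fun _ => zero_le_one) hu
  simp only [one_mul] at h
  refine h.trans ?_
  have e : ∑' x, u x ^ 2 - α / Λ * ∑' x, ∑ i, discreteGrad u x i ^ 2
      = ∑' x, u x ^ 2 + Λ⁻¹ * ∑' x, -(α * ∑ i, discreteGrad u x i ^ 2) := by
    rw [tsum_neg, tsum_mul_left]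
    ring
  rw [e]
  have sD : Summable fun x => ∑ i, discreteGrad u x i ^ 2 := summable_sum fun i _ =>
    summable_of_support (support_discreteGrad hu i) fun x hx => by simp [hx]
  refine add_le_add_right (mul_le_mul_of_nonneg_left
    (Summable.tsum_le_tsum (fun x => ?_) ?_ (sD.mul_left α).neg) (inv_pos.2 hΛ0).le) _
  · rw [Finset.mul_sum, ← Finset.sum_neg_distrib]
    refine Finset.sum_le_sum fun i _ => ?_
    have := mul_le_mul_of_nonneg_right (ha x i).1 (sq_nonneg (discreteGrad u x i))
    have e : discreteGrad (fun _ : Fin d → ℤ => (1 : ℝ)) x i = 0 := by simp [discreteGrad]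
    rw [e]
    linarith
  · exact summable_sum fun i _ =>
      summable_of_support (support_discreteGrad hu i) fun x hx => by simp [hx]

theorem tsum_walkKernel_sq_le_one {a : (Fin d → ℤ) → Fin d → ℝ} (hα : 0 < α)
    (ha : IsConductivity α β a) (hΛ0 : 0 < Λ) (hΛ : 4 * d * β ≤ Λ) (y : Fin d → ℤ) (n : ℕ) :
    ∑' x, walkKernel a Λ y n x ^ 2 ≤ 1 := by
  induction n with
  | zero =>
    rw [walkKernel_zero, tsum_eq_single y (fun z hz => by simp [hz])]
    simp
  | succ n ih =>
    rw [walkKernel_succ]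
    have h := tsum_walkStep_sq_le hα ha hΛ0 hΛ (support_walkKernel a Λ y n)
    have h0 : 0 ≤ α / Λ * ∑' x, ∑ i, discreteGrad (walkKernel a Λ y n) x i ^ 2 :=
      mul_nonneg (by positivity) (tsum_nonneg fun x => Finset.sum_nonneg fun i _ => sq_nonneg _)
    linarith

/-- Bernoulli's inequality for negative exponents, in homogeneous form. -/
theorem rpow_neg_mul_le_add_one_rpow {N s : ℝ} (hN : 0 < N) (hs : 0 ≤ s) :
    N ^ (-s) * (1 - s / N) ≤ (N + 1) ^ (-s) := by
  have h1 : N + 1 = N * (1 + 1 / N) := by field_simp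
  rw [h1, Real.mul_rpow hN.le (by positivity)]
  refine mul_le_mul_of_nonneg_left ?_ (by positivity)
  calc 1 - s / N ≤ Real.exp (-(s / N)) := by linarith [Real.add_one_le_exp (-(s / N))]
    _ = Real.exp (1 / N) ^ (-s) := by rw [← Real.exp_mul]; congr 1; ring
    _ ≤ (1 + 1 / N) ^ (-s) :=
      Real.rpow_le_rpow_of_nonpos (by positivity) (by linarith [Real.add_one_le_exp (1 / N)])
        (by linarith)

/-- The on-diagonal heat kernel bound: Nash's inequality at scale `r ≈ √n` turns the energy
balance into `E (n + 1) ≤ (1 - d / (n + 1)) E n + O(n ^ (-d / 2 - 1))`. -/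
theorem exists_tsum_walkKernel_sq_le (hd : 0 < d) (hα : 0 < α) (hΛ0 : 0 < Λ)
    (hΛ : 4 * d * β ≤ Λ) : ∃ C : ℝ, 0 < C ∧ ∀ a : (Fin d → ℤ) → Fin d → ℝ,
      IsConductivity α β a → ∀ (y : Fin d → ℤ) (n : ℕ),
        ∑' x, walkKernel a Λ y n x ^ 2 ≤ C * ((n : ℝ) + 1) ^ (-(d / 2 : ℝ)) := by
  have hd' : (0 : ℝ) < d := by exact_mod_cast hd
  obtain ⟨κ, hκ⟩ : ∃ κ, κ = α / Λ := ⟨_, rfl⟩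
  have hκ0 : 0 < κ := by rw [hκ]; positivity
  -- `θ √N` is the scale at which the gain `κ / (2 d r²)` in one step is at least `d / N`
  obtain ⟨θ, hθ⟩ : ∃ θ, θ = √(κ / (2 * d ^ 2)) := ⟨_, rfl⟩
  have hθ0 : 0 < θ := by rw [hθ]; positivity
  have hθ2 : θ ^ 2 = κ / (2 * d ^ 2) := by rw [hθ, Real.sq_sqrt (by positivity)]
  obtain ⟨B, hB⟩ : ∃ B, B = κ / d * (2 / θ) ^ (d + 2) := ⟨_, rfl⟩
  have hB0 : 0 < B := by rw [hB]; positivity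
  obtain ⟨M, hM⟩ : ∃ M : ℝ, M = d + 1 / θ ^ 2 + 1 := ⟨_, rfl⟩
  have hM0 : 1 ≤ M := by rw [hM]; linarith [one_div_pos.2 (pow_pos hθ0 2)]
  refine ⟨2 * B / d + M ^ (d / 2 : ℝ), by positivity, fun a ha y n => ?_⟩
  obtain ⟨A, hA⟩ : ∃ A, A = 2 * B / d + M ^ (d / 2 : ℝ) := ⟨_, rfl⟩
  have hA0 : 0 < A := by rw [hA]; positivity
  have hAB : B ≤ A * (d / 2) := by
    have h1 : 2 * B / d ≤ A := by
      rw [hA]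
      linarith [Real.rpow_pos_of_pos (by linarith : 0 < M) (d / 2 : ℝ)]
    calc B = 2 * B / d * (d / 2) := by field_simp
      _ ≤ _ := by gcongr
  rw [← hA]
  have small : ∀ n : ℕ, (n : ℝ) + 1 ≤ M →
      ∑' x, walkKernel a Λ y n x ^ 2 ≤ A * ((n : ℝ) + 1) ^ (-(d / 2 : ℝ)) := fun n hn => by
    refine (tsum_walkKernel_sq_le_one hα ha hΛ0 hΛ y n).trans ?_
    have hN : (0 : ℝ) < (n : ℝ) + 1 := by positivity
    rw [Real.rpow_neg hN.le, ← div_eq_mul_inv, one_le_div (by positivity)]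
    have h1 : ((n : ℝ) + 1) ^ (d / 2 : ℝ) ≤ M ^ (d / 2 : ℝ) := by gcongr
    have : 0 < 2 * B / d := by positivity
    linarith
  induction n with
  | zero => exact small 0 (by simpa using hM0)
  | succ n ih =>
    obtain ⟨N, hN⟩ : ∃ N : ℝ, N = (n : ℝ) + 1 := ⟨_, rfl⟩
    have hN0 : 0 < N := by rw [hN]; positivity
    by_cases hNM : N + 1 ≤ M
    · exact small (n + 1) (by push_cast; rw [← hN]; exact hNM)
    push Not at hNM
    have hNd : (d : ℝ) ≤ N := by
      rw [hM] at hNM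
      linarith [one_div_pos.2 (pow_pos hθ0 2)]
    have hNθ : 1 ≤ θ * √N := by
      have h1 : 1 / θ ^ 2 ≤ N := by rw [hM] at hNM; linarith
      rw [div_le_iff₀ (by positivity)] at h1
      have h2 : 1 ≤ (θ * √N) ^ 2 := by rw [mul_pow, Real.sq_sqrt hN0.le]; linarith
      nlinarith [mul_nonneg hθ0.le (Real.sqrt_nonneg N)]
    obtain ⟨r, hr⟩ : ∃ r, r = ⌊θ * √N⌋₊ := ⟨_, rfl⟩
    have hr0 : 0 < r := by rw [hr]; exact Nat.floor_pos.2 hNθ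
    have hr0' : (0 : ℝ) < r := by exact_mod_cast hr0
    have hr1 : (r : ℝ) ≤ θ * √N := by rw [hr]; exact Nat.floor_le (by positivity)
    have hr2 : θ / 2 * √N ≤ r := by
      have h1 := Nat.lt_floor_add_one (θ * √N)
      rw [← hr] at h1
      have h2 : (1 : ℝ) ≤ r := by exact_mod_cast hr0
      linarith
    have hstep := tsum_walkStep_sq_le hα ha hΛ0 hΛ (support_walkKernel a Λ y n)
    rw [← walkKernel_succ, ← hκ] at hstep
    have hnash := tsum_sq_le_nash (support_walkKernel a Λ y n) hr0
    have hl1 : (∑' x, |walkKernel a Λ y n x|) ^ 2 / (r : ℝ) ^ d ≤ 1 / (r : ℝ) ^ d := by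
      gcongr
      exact pow_le_one₀ (tsum_nonneg fun x => abs_nonneg _)
        (tsum_abs_walkKernel_le hα ha hΛ0 hΛ y n)
    have hE0 : 0 ≤ ∑' x, walkKernel a Λ y n x ^ 2 := tsum_nonneg fun x => sq_nonneg _
    rw [← hN] at ih
    push_cast
    rw [← hN]
    generalize ∑' x, walkKernel a Λ y (n + 1) x ^ 2 = E' at *
    generalize ∑' x, walkKernel a Λ y n x ^ 2 = E at *
    generalize ∑' x, ∑ i, discreteGrad (walkKernel a Λ y n) x i ^ 2 = D at *
    have g1 : (d : ℝ) / N ≤ κ / (2 * d * r ^ 2) := by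
      have h1 : (r : ℝ) ^ 2 ≤ θ ^ 2 * N := by
        calc (r : ℝ) ^ 2 ≤ (θ * √N) ^ 2 := by gcongr
          _ = θ ^ 2 * N := by rw [mul_pow, Real.sq_sqrt hN0.le]
      rw [div_le_div_iff₀ hN0 (by positivity)]
      calc (d : ℝ) * (2 * d * r ^ 2) ≤ d * (2 * d * (θ ^ 2 * N)) := by gcongr
        _ = κ * N := by rw [hθ2]; field_simp
    have g2 : κ / d * (1 / (r : ℝ) ^ (d + 2)) ≤ B * (N ^ (-(d / 2 : ℝ)) / N) := by
      have h1 : (θ / 2) ^ (d + 2) * (N ^ (d / 2 : ℝ) * N) ≤ (r : ℝ) ^ (d + 2) := by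
        calc (θ / 2) ^ (d + 2) * (N ^ (d / 2 : ℝ) * N) = (θ / 2 * √N) ^ (d + 2) := by
              rw [mul_pow, pow_add (√N), Real.sq_sqrt hN0.le, Real.sqrt_eq_rpow,
                ← Real.rpow_natCast (N ^ (1 / 2 : ℝ)), ← Real.rpow_mul hN0.le]
              congr 3
              ring
          _ ≤ _ := by gcongr
      calc κ / d * (1 / (r : ℝ) ^ (d + 2))
          ≤ κ / d * (1 / ((θ / 2) ^ (d + 2) * (N ^ (d / 2 : ℝ) * N))) := by gcongr
        _ = B * (N ^ (-(d / 2 : ℝ)) / N) := by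
          rw [hB, Real.rpow_neg hN0.le, div_pow, div_pow]
          field_simp
    have g3 : E' ≤ E * (1 - κ / (2 * d * r ^ 2)) + κ / d * (1 / (r : ℝ) ^ (d + 2)) := by
      have h1 : E ≤ 2 * (d * r ^ 2 * D) + 2 * (1 / r ^ d) := by linarith
      have h2 : κ / (2 * d * r ^ 2) * E ≤ κ * D + κ / d * (1 / (r : ℝ) ^ (d + 2)) := by
        calc κ / (2 * d * r ^ 2) * E
            ≤ κ / (2 * d * r ^ 2) * (2 * (d * r ^ 2 * D) + 2 * (1 / r ^ d)) := by gcongr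
          _ = _ := by rw [pow_add]; field_simp
      linarith
    calc E' ≤ E * (1 - d / N) + B * (N ^ (-(d / 2 : ℝ)) / N) := by
          have := mul_le_mul_of_nonneg_left g1 hE0
          linarith
      _ ≤ A * N ^ (-(d / 2 : ℝ)) * (1 - d / N) + A * (d / 2) * (N ^ (-(d / 2 : ℝ)) / N) := by
          have : 0 ≤ 1 - d / N := by rw [sub_nonneg, div_le_one hN0]; exact hNd
          gcongr
      _ = A * (N ^ (-(d / 2 : ℝ)) * (1 - d / 2 / N)) := by field_simp; ring
      _ ≤ A * (N + 1) ^ (-(d / 2 : ℝ)) := by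
          gcongr
          exact rpow_neg_mul_le_add_one_rpow hN0 (by positivity)

end Decay

/-! ### Spread of the heat kernel in weighted `ℓ²` -/

section Weights

variable {d : ℕ} {α β Λ : ℝ}

/-- The smooth weight `1 + |z - y|²`. -/
noncomputable def distWeight (y z : Fin d → ℤ) : ℝ := 1 + ∑ i, ((z i : ℝ) - (y i : ℝ)) ^ 2

theorem one_le_distWeight (y z : Fin d → ℤ) : 1 ≤ distWeight y z :=
  le_add_of_nonneg_right (Finset.sum_nonneg fun _ _ => sq_nonneg _)

theorem distWeight_eq (x y : Fin d → ℤ) : distWeight y x = 1 + latticeDist x y ^ 2 := by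
  rw [distWeight, latticeDist, Real.sq_sqrt (Finset.sum_nonneg fun _ _ => sq_nonneg _)]

theorem distWeight_add_single (y z : Fin d → ℤ) (i : Fin d) :
    distWeight y (z + Pi.single i 1) = distWeight y z + (2 * ((z i : ℝ) - y i) + 1) := by
  have h : ∑ j, (((((z + Pi.single i 1 : Fin d → ℤ) j : ℤ) : ℝ) - (y j : ℝ)) ^ 2
      - ((z j : ℝ) - (y j : ℝ)) ^ 2) = 2 * ((z i : ℝ) - y i) + 1 := by
    rw [Finset.sum_eq_single i (fun j _ hj => by simp [hj]) (by simp)]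
    simp
    ring
  rw [Finset.sum_sub_distrib] at h
  rw [distWeight, distWeight]
  linarith

theorem sq_le_distWeight (y z : Fin d → ℤ) (i : Fin d) :
    1 + ((z i : ℝ) - y i) ^ 2 ≤ distWeight y z := by
  rw [distWeight]
  gcongr
  exact Finset.single_le_sum (f := fun i => ((z i : ℝ) - (y i : ℝ)) ^ 2)
    (fun _ _ => sq_nonneg _) (Finset.mem_univ i)

/-- Neighbouring weights are comparable and their difference is of the order of their root. -/
theorem distWeight_neighbour (y z : Fin d → ℤ) (i : Fin d) :
    distWeight y (z + Pi.single i 1) ≤ 3 * distWeight y z ∧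
    distWeight y z ≤ 3 * distWeight y (z + Pi.single i 1) ∧
    (distWeight y (z + Pi.single i 1) - distWeight y z) ^ 2
      ≤ 2 * (distWeight y (z + Pi.single i 1) + distWeight y z) := by
  have h1 := sq_le_distWeight y z i
  have h2 := sq_le_distWeight y (z + Pi.single i 1) i
  have h := distWeight_add_single y z i
  simp only [Pi.add_apply, Pi.single_eq_same, Int.cast_add, Int.cast_one] at h2
  have e : (z i : ℝ) + 1 - y i = ((z i : ℝ) - y i) + 1 := by ring
  rw [e] at h2
  generalize (z i : ℝ) - y i = t at *
  refine ⟨?_, ?_, ?_⟩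
  · nlinarith [sq_nonneg (t - 1)]
  · nlinarith [sq_nonneg (t + 2)]
  · have e2 : distWeight y (z + Pi.single i 1) - distWeight y z = 2 * t + 1 := by linarith
    rw [e2]
    nlinarith

theorem sq_pow_sub_pow_le {p q : ℝ} (hp : 0 < p) (hq : 0 < q) (h3 : q ≤ 3 * p) (h3' : p ≤ 3 * q)
    (h : (q - p) ^ 2 ≤ 2 * (q + p)) (k : ℕ) :
    (q ^ (k + 1) - p ^ (k + 1)) ^ 2
      ≤ 4 * (k + 1) ^ 2 * 3 ^ k * min p q ^ k * (p ^ (k + 1) + q ^ (k + 1)) := by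
  have h1 := abs_pow_sub_pow_le q p (k + 1)
  rw [abs_of_pos hp, abs_of_pos hq, Nat.add_sub_cancel] at h1
  push_cast at h1
  have hM : 0 < max q p := lt_max_of_lt_left hq
  have h2 : max q p ≤ 3 * min p q := by
    rcases le_total p q with hpq | hpq
    · rwa [max_eq_left hpq, min_eq_left hpq]
    · rwa [max_eq_right hpq, min_eq_right hpq]
  have h4 : q + p ≤ 2 * max q p := by linarith [le_max_left q p, le_max_right q p]
  have h5 : max q p ^ (k + 1) ≤ p ^ (k + 1) + q ^ (k + 1) := by
    rcases le_total p q with hpq | hpq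
    · rw [max_eq_left hpq]; linarith [pow_pos hp (k + 1)]
    · rw [max_eq_right hpq]; linarith [pow_pos hq (k + 1)]
  calc (q ^ (k + 1) - p ^ (k + 1)) ^ 2 = |q ^ (k + 1) - p ^ (k + 1)| ^ 2 := (sq_abs _).symm
    _ ≤ (|q - p| * (k + 1) * max q p ^ k) ^ 2 := by gcongr
    _ = (q - p) ^ 2 * ((k + 1) ^ 2 * max q p ^ k * max q p ^ k) := by
        rw [mul_pow, mul_pow, sq_abs]; ring
    _ ≤ (2 * (2 * max q p)) * ((k + 1) ^ 2 * max q p ^ k * max q p ^ k) := by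
        gcongr
        linarith
    _ = 4 * (k + 1) ^ 2 * max q p ^ k * max q p ^ (k + 1) := by ring
    _ ≤ 4 * (k + 1) ^ 2 * (3 * min p q) ^ k * (p ^ (k + 1) + q ^ (k + 1)) := by gcongr
    _ = _ := by rw [mul_pow]; ring

/-- One step changes the `m`-th weighted `ℓ²` norm by at most a multiple of the `(m - 1)`-st. -/
theorem tsum_distWeight_walkStep_sq_le {a : (Fin d → ℤ) → Fin d → ℝ} (hα : 0 < α)
    (ha : IsConductivity α β a) (hΛ0 : 0 < Λ) (hΛ : 4 * d * β ≤ Λ) {u : (Fin d → ℤ) → ℝ}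
    (hu : u.support.Finite) (y : Fin d → ℤ) (k : ℕ) :
    ∑' x, distWeight y x ^ (k + 1) * walkStep a Λ u x ^ 2
      ≤ ∑' x, distWeight y x ^ (k + 1) * u x ^ 2
        + 2 * (k + 1) ^ 2 * 3 ^ k * ∑' x, distWeight y x ^ k * u x ^ 2 := by
  have hpos : ∀ x, 0 < distWeight y x := fun x => zero_lt_one.trans_le (one_le_distWeight y x)
  obtain ⟨K, hK⟩ : ∃ K : ℝ, K = 4 * (k + 1) ^ 2 * 3 ^ k := ⟨_, rfl⟩
  have hK0 : 0 < K := by rw [hK]; positivity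
  refine (tsum_weight_walkStep_sq_le hα ha hΛ0 hΛ (w := fun x => distWeight y x ^ (k + 1))
    (fun x => (pow_pos (hpos x) _).le) hu).trans ?_
  have s0 : Summable fun x => distWeight y x ^ k * u x ^ 2 :=
    summable_of_support hu fun x hx => by simp [hx]
  have s1 : ∀ i, Summable fun x =>
      distWeight y (x + Pi.single i 1) ^ k * u (x + Pi.single i 1) ^ 2 := fun i =>
    summable_of_support (support_shift hu (Pi.single i 1)) fun x hx => by simp [hx]
  have edge : ∀ x i, a x i * (-(1 / 2) * (distWeight y x ^ (k + 1)
        + distWeight y (x + Pi.single i 1) ^ (k + 1)) * discreteGrad u x i ^ 2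
        - discreteGrad (fun x => distWeight y x ^ (k + 1)) x i
          * (u x + u (x + Pi.single i 1)) * discreteGrad u x i)
      ≤ β * K * (distWeight y x ^ k * u x ^ 2
        + distWeight y (x + Pi.single i 1) ^ k * u (x + Pi.single i 1) ^ 2) := fun x i => by
    obtain ⟨n1, n2, n3⟩ := distWeight_neighbour y x i
    have hp := hpos x
    have hq := hpos (x + Pi.single i 1)
    have hb := sq_pow_sub_pow_le hp hq n1 n2 n3 k
    rw [← hK] at hb
    have e : discreteGrad (fun x => distWeight y x ^ (k + 1)) x i
        = distWeight y (x + Pi.single i 1) ^ (k + 1) - distWeight y x ^ (k + 1) := rfl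
    rw [e]
    have hm0 : 0 < min (distWeight y x) (distWeight y (x + Pi.single i 1)) := lt_min hp hq
    have hm1 := pow_le_pow_left₀ hm0.le (min_le_left _ (distWeight y (x + Pi.single i 1))) k
    have hm2 := pow_le_pow_left₀ hm0.le (min_le_right (distWeight y x) _) k
    have hm := pow_pos hm0 k
    have hS := add_pos (pow_pos hp (k + 1)) (pow_pos hq (k + 1))
    have ha0 := hα.trans_le (ha x i).1
    have haβ := (ha x i).2
    generalize discreteGrad u x i = D at *
    generalize u (x + Pi.single i 1) = u' at *
    generalize u x = v at *
    generalize distWeight y (x + Pi.single i 1) ^ (k + 1) = w' at *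
    generalize distWeight y x ^ (k + 1) = w at *
    generalize min (distWeight y x) (distWeight y (x + Pi.single i 1)) ^ k = m at *
    generalize distWeight y (x + Pi.single i 1) ^ k = q at *
    generalize distWeight y x ^ k = p at *
    -- completing the square in the gradient
    have h1 : -(1 / 2) * (w + w') * D ^ 2 - (w' - w) * (v + u') * D
        ≤ (w' - w) ^ 2 * (v + u') ^ 2 / (2 * (w + w')) := by
      rw [le_div_iff₀ (by positivity)]
      nlinarith [sq_nonneg ((w + w') * D + (w' - w) * (v + u'))]
    have h2 : (w' - w) ^ 2 * (v + u') ^ 2 / (2 * (w + w')) ≤ K * (p * v ^ 2 + q * u' ^ 2) := by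
      rw [div_le_iff₀ (by positivity)]
      calc (w' - w) ^ 2 * (v + u') ^ 2 ≤ K * m * (w + w') * (2 * (v ^ 2 + u' ^ 2)) := by
            gcongr
            nlinarith [sq_nonneg (v - u')]
        _ = K * (m * v ^ 2 + m * u' ^ 2) * (2 * (w + w')) := by ring
        _ ≤ _ := by gcongr
    have h3 : 0 ≤ K * (p * v ^ 2 + q * u' ^ 2) := by
      have : 0 < p := hm.trans_le hm1
      have : 0 < q := hm.trans_le hm2
      positivity
    calc _ ≤ a x i * (K * (p * v ^ 2 + q * u' ^ 2)) :=
          mul_le_mul_of_nonneg_left (h1.trans h2) ha0.le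
      _ ≤ β * (K * (p * v ^ 2 + q * u' ^ 2)) := by gcongr
      _ = _ := by ring
  have sL : Summable fun x => ∑ i, a x i * (-(1 / 2) * (distWeight y x ^ (k + 1)
        + distWeight y (x + Pi.single i 1) ^ (k + 1)) * discreteGrad u x i ^ 2
        - discreteGrad (fun x => distWeight y x ^ (k + 1)) x i
          * (u x + u (x + Pi.single i 1)) * discreteGrad u x i) :=
    summable_sum fun i _ =>
      summable_of_support (support_discreteGrad hu i) fun x hx => by simp [hx]
  have hS0 : 0 ≤ ∑' x, distWeight y x ^ k * u x ^ 2 :=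
    tsum_nonneg fun x => mul_nonneg (pow_pos (hpos x) k).le (sq_nonneg _)
  rw [add_le_add_iff_left, inv_mul_le_iff₀ hΛ0]
  calc _ ≤ ∑' x, ∑ i, β * K * (distWeight y x ^ k * u x ^ 2
        + distWeight y (x + Pi.single i 1) ^ k * u (x + Pi.single i 1) ^ 2) :=
        sL.tsum_le_tsum (fun x => Finset.sum_le_sum fun i _ => edge x i)
          (summable_sum fun i _ => (s0.add (s1 i)).mul_left _)
    _ = ∑ _i : Fin d, β * K * (2 * ∑' x, distWeight y x ^ k * u x ^ 2) := by
        rw [Summable.tsum_finsetSum fun i _ => (s0.add (s1 i)).mul_left _]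
        refine Finset.sum_congr rfl fun i _ => ?_
        rw [tsum_mul_left, s0.tsum_add (s1 i),
          tsum_shift (fun x => distWeight y x ^ k * u x ^ 2) (Pi.single i 1)]
        ring
    _ = 4 * d * β * (K / 2 * ∑' x, distWeight y x ^ k * u x ^ 2) := by
        rw [Finset.sum_const, Finset.card_univ, Fintype.card_fin, nsmul_eq_mul]
        ring
    _ ≤ Λ * (K / 2 * ∑' x, distWeight y x ^ k * u x ^ 2) := by gcongr
    _ = _ := by rw [hK]; ring

/-- Young's inequality, which interpolates the `k`-th power between the `(k + 1)`-st and the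
zeroth. -/
theorem pow_le_mul_pow_succ_add {ρ ε : ℝ} (hρ : 0 ≤ ρ) (hε : 0 < ε) (k : ℕ) :
    ρ ^ k ≤ ε * ρ ^ (k + 1) + (ε⁻¹) ^ k := by
  rcases le_total ε⁻¹ ρ with h | h
  · have h1 : 1 ≤ ε * ρ := by rwa [inv_le_iff_one_le_mul₀' hε] at h
    have h2 := mul_le_mul_of_nonneg_right h1 (pow_nonneg hρ k)
    have : 0 ≤ ε⁻¹ ^ k := by positivity
    rw [pow_succ]
    linarith
  · have h1 := pow_le_pow_left₀ hρ h k
    have : 0 ≤ ε * ρ ^ (k + 1) := by positivity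
    linarith

/-- Growth of the weighted `ℓ²` norms of the heat kernel. The exponent `m = k + 1` is taken at
least `d`, so that `m - d / 2 ≥ 1`: the bound then propagates from step to step after
interpolating the `(m - 1)`-st norm between the `m`-th and the unweighted one. -/
theorem exists_tsum_distWeight_walkKernel_sq_le (hd : 2 ≤ d) (hα : 0 < α) (hΛ0 : 0 < Λ)
    (hΛ : 4 * d * β ≤ Λ) {k : ℕ} (hk : d ≤ k + 1) : ∃ C : ℝ, 0 < C ∧
      ∀ a : (Fin d → ℤ) → Fin d → ℝ, IsConductivity α β a → ∀ (y : Fin d → ℤ) (n : ℕ),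
        ∑' x, distWeight y x ^ (k + 1) * walkKernel a Λ y n x ^ 2
          ≤ C * ((n : ℝ) + 1) ^ ((k : ℝ) + 1 - d / 2) := by
  obtain ⟨C, hC0, hC⟩ := exists_tsum_walkKernel_sq_le (by lia : 0 < d) hα hΛ0 hΛ
  obtain ⟨K, hK⟩ : ∃ K : ℝ, K = 2 * (k + 1) ^ 2 * 3 ^ k := ⟨_, rfl⟩
  have hK0 : 0 < K := by rw [hK]; positivity
  obtain ⟨B, hB⟩ : ∃ B : ℝ, B = K * (2 * K) ^ k * C := ⟨_, rfl⟩
  have hB0 : 0 < B := by rw [hB]; positivity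
  refine ⟨1 + 2 * B, by positivity, fun a ha y n => ?_⟩
  have hpos : ∀ x, 0 < distWeight y x := fun x => zero_lt_one.trans_le (one_le_distWeight y x)
  induction n with
  | zero =>
    rw [walkKernel_zero, tsum_eq_single y (fun z hz => by simp [hz])]
    simp [distWeight]
    linarith
  | succ n ih =>
    have hstep := tsum_distWeight_walkStep_sq_le hα ha hΛ0 hΛ (support_walkKernel a Λ y n) y k
    rw [← walkKernel_succ, ← hK] at hstep
    have hE := hC a ha y n
    have hu := support_walkKernel a Λ y n
    push_cast
    obtain ⟨N, hN⟩ : ∃ N : ℝ, N = (n : ℝ) + 1 := ⟨_, rfl⟩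
    have hN0 : 0 < N := by rw [hN]; positivity
    rw [← hN] at ih hE ⊢
    -- with the interpolation parameter `1 / (2 K N)` the growth factor of one step is
    -- `1 + 1 / (2 N)`, below the factor `1 + s / N` of the claimed bound
    have hε : 0 < 1 / (2 * K * N) := by positivity
    have hint : ∑' x, distWeight y x ^ k * walkKernel a Λ y n x ^ 2
        ≤ 1 / (2 * K * N) * ∑' x, distWeight y x ^ (k + 1) * walkKernel a Λ y n x ^ 2
          + (2 * K * N) ^ k * ∑' x, walkKernel a Λ y n x ^ 2 := by
      have s1 : Summable fun x => distWeight y x ^ (k + 1) * walkKernel a Λ y n x ^ 2 :=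
        summable_of_support hu fun x hx => by simp [hx]
      have s2 : Summable fun x => walkKernel a Λ y n x ^ 2 :=
        summable_of_support hu fun x hx => by simp [hx]
      rw [← tsum_mul_left, ← tsum_mul_left, ← (s1.mul_left _).tsum_add (s2.mul_left _)]
      refine Summable.tsum_le_tsum (fun x => ?_)
        (summable_of_support hu fun x hx => by simp [hx]) ((s1.mul_left _).add (s2.mul_left _))
      have h := mul_le_mul_of_nonneg_right (pow_le_mul_pow_succ_add (hpos x).le hε k)
        (sq_nonneg (walkKernel a Λ y n x))
      rw [one_div, inv_inv] at h
      rw [one_div]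
      linarith
    generalize ∑' x, distWeight y x ^ (k + 1) * walkKernel a Λ y (n + 1) x ^ 2 = W' at *
    generalize ∑' x, distWeight y x ^ (k + 1) * walkKernel a Λ y n x ^ 2 = W at *
    generalize ∑' x, distWeight y x ^ k * walkKernel a Λ y n x ^ 2 = V at *
    generalize ∑' x, walkKernel a Λ y n x ^ 2 = E at *
    obtain ⟨s, hs⟩ : ∃ s : ℝ, s = (k : ℝ) + 1 - d / 2 := ⟨_, rfl⟩
    have hs1 : 1 ≤ s := by
      have h1 : (d : ℝ) ≤ k + 1 := by exact_mod_cast hk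
      have h2 : (2 : ℝ) ≤ d := by exact_mod_cast hd
      rw [hs]; linarith
    rw [← hs] at ih ⊢
    have hNs : N ^ k * N ^ (-(d / 2 : ℝ)) = N ^ s / N := by
      rw [← Real.rpow_natCast, ← Real.rpow_add hN0, ← Real.rpow_sub_one hN0.ne', hs]
      congr 1
      ring
    have hgrow : N ^ s * (1 + 1 / N) ≤ (N + 1) ^ s := by
      have h1 : N + 1 = N * (1 + 1 / N) := by field_simp
      rw [h1, Real.mul_rpow hN0.le (by positivity)]
      gcongr
      have h2 := one_add_mul_self_le_rpow_one_add (s := 1 / N)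
        (by linarith [one_div_pos.2 hN0]) hs1
      have h3 := mul_le_mul_of_nonneg_right hs1 (one_div_pos.2 hN0).le
      linarith
    calc W' ≤ W + K * V := hstep
      _ ≤ W + K * (1 / (2 * K * N) * W + (2 * K * N) ^ k * (C * N ^ (-(d / 2 : ℝ)))) := by
          gcongr
          exact hint.trans (by gcongr)
      _ = W * (1 + 1 / (2 * N)) + B * (N ^ k * N ^ (-(d / 2 : ℝ))) := by
          rw [hB, mul_pow (2 * K) N]
          field_simp
          ring
      _ ≤ (1 + 2 * B) * N ^ s * (1 + 1 / (2 * N)) + B * (N ^ s / N) := by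
          rw [hNs]
          gcongr
      _ ≤ (1 + 2 * B) * (N ^ s * (1 + 1 / N)) := by
          have : 0 ≤ N ^ s / N := by positivity
          have e : (1 + 2 * B) * (N ^ s * (1 + 1 / N)) - ((1 + 2 * B) * N ^ s * (1 + 1 / (2 * N))
            + B * (N ^ s / N)) = 1 / 2 * (N ^ s / N) := by field_simp; ring
          linarith
      _ ≤ _ := by gcongr

end Weights

/-! ### Pointwise heat kernel bounds -/

section Pointwise

variable {d : ℕ} {α β Λ : ℝ}

theorem distWeight_le_add (x y z : Fin d → ℤ) :
    distWeight y x ≤ 2 * (distWeight y z + distWeight x z) := by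
  have h : ∑ i, ((x i : ℝ) - y i) ^ 2
      ≤ 2 * (∑ i, ((z i : ℝ) - y i) ^ 2 + ∑ i, ((z i : ℝ) - x i) ^ 2) := by
    rw [← Finset.sum_add_distrib, Finset.mul_sum]
    refine Finset.sum_le_sum fun i _ => ?_
    nlinarith [sq_nonneg (2 * (z i : ℝ) - y i - x i)]
  simp only [distWeight]
  linarith

/-- The off-diagonal heat kernel bound with polynomial decay of arbitrary order: split the path at
half time, and use that its midpoint is far from one of the end points. -/
theorem exists_abs_walkKernel_le (hd : 2 ≤ d) (hα : 0 < α) (hΛ0 : 0 < Λ) (hΛ : 4 * d * β ≤ Λ)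
    {p : ℕ} (hp : d ≤ 2 * p) : ∃ C : ℝ, 0 < C ∧
      ∀ a : (Fin d → ℤ) → Fin d → ℝ, IsConductivity α β a → ∀ (x y : Fin d → ℤ) (n : ℕ),
        |walkKernel a Λ y n x| ≤ C * (((n : ℝ) + 1) ^ (-(d / 2 : ℝ)) *
          min 1 ((((n : ℝ) + 1) / distWeight y x) ^ p)) := by
  obtain ⟨k, hk⟩ : ∃ k, 2 * p = k + 1 := ⟨2 * p - 1, by lia⟩
  obtain ⟨C₁, hC₁, h₁⟩ := exists_tsum_walkKernel_sq_le (by lia : 0 < d) hα hΛ0 hΛ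
  obtain ⟨C₂, hC₂, h₂⟩ := exists_tsum_distWeight_walkKernel_sq_le hd hα hΛ0 hΛ (hk ▸ hp)
  obtain ⟨D, hD⟩ : ∃ D : ℝ, D = C₁ * 2 ^ (d / 2 : ℝ) := ⟨_, rfl⟩
  have hD0 : 0 < D := by rw [hD]; positivity
  refine ⟨2 ^ p * 2 ^ p * (C₂ + D) , by positivity, fun a ha x y N => ?_⟩
  obtain ⟨n, l, hnl, hn, hl⟩ : ∃ n l : ℕ, n + l = N ∧ N + 1 ≤ 2 * (n + 1) ∧ N + 1 ≤ 2 * (l + 1) :=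
    ⟨N / 2, N - N / 2, by lia, by lia, by lia⟩
  obtain ⟨R, hR⟩ : ∃ R : ℝ, R = (N : ℝ) + 1 := ⟨_, rfl⟩
  have hR0 : 0 < R := by rw [hR]; positivity
  have hE : ∀ y (m : ℕ), N + 1 ≤ 2 * (m + 1) →
      ∑' z, walkKernel a Λ y m z ^ 2 ≤ D * R ^ (-(d / 2 : ℝ)) := fun y m hm => by
    refine (h₁ a ha y m).trans ?_
    rw [hD, mul_assoc]
    gcongr
    have hm' : R / 2 ≤ (m : ℝ) + 1 := by
      rw [hR, div_le_iff₀ two_pos, mul_comm]; exact_mod_cast hm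
    calc ((m : ℝ) + 1) ^ (-(d / 2 : ℝ)) ≤ (R / 2) ^ (-(d / 2 : ℝ)) :=
          Real.rpow_le_rpow_of_nonpos (by positivity) hm' (by simp; positivity)
      _ = 2 ^ (d / 2 : ℝ) * R ^ (-(d / 2 : ℝ)) := by
        rw [Real.div_rpow hR0.le two_pos.le, Real.rpow_neg two_pos.le, div_inv_eq_mul, mul_comm]
  have hW : ∀ y (m : ℕ), m ≤ N →
      ∑' z, distWeight y z ^ (2 * p) * walkKernel a Λ y m z ^ 2
        ≤ C₂ * (R ^ p * (R ^ p * R ^ (-(d / 2 : ℝ)))) := fun y m hm => by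
    rw [hk]
    refine (h₂ a ha y m).trans ?_
    have e : R ^ p * (R ^ p * R ^ (-(d / 2 : ℝ))) = R ^ ((k : ℝ) + 1 - d / 2) := by
      rw [← mul_assoc, ← pow_add, ← two_mul, hk, ← Real.rpow_natCast, ← Real.rpow_add hR0]
      congr 1
      push_cast
      ring
    rw [e, hR]
    have h1 : (d : ℝ) ≤ k + 1 := by exact_mod_cast hk ▸ hp
    have h2 : (0 : ℝ) ≤ d := by positivity
    have h3 : (m : ℝ) ≤ N := by exact_mod_cast hm
    gcongr
    linarith
  have hu := support_walkKernel a Λ y n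
  have hv := support_walkKernel a Λ x l
  have hpos : ∀ y x : Fin d → ℤ, 0 < distWeight y x :=
    fun y x => zero_lt_one.trans_le (one_le_distWeight y x)
  rw [← hnl, walkKernel_add, hnl, ← hR]
  have habs : |∑' z, walkKernel a Λ y n z * walkKernel a Λ x l z|
      ≤ ∑' z, |walkKernel a Λ y n z| * |walkKernel a Λ x l z| := by
    have h := norm_tsum_le_tsum_norm (f := fun z => walkKernel a Λ y n z * walkKernel a Λ x l z)
      (summable_of_support hu fun z hz => by simp [hz])
    simpa only [Real.norm_eq_abs, abs_mul] using h
  refine habs.trans ?_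
  have hEn := hE y n hn
  have hEl := hE x l hl
  have hWn := hW y n (by lia)
  have hWl := hW x l (by lia)
  generalize walkKernel a Λ y n = u at *
  generalize walkKernel a Λ x l = v at *
  have su : Summable fun z => u z ^ 2 := summable_of_support hu fun z hz => by simp [hz]
  have sv : Summable fun z => v z ^ 2 := summable_of_support hv fun z hz => by simp [hz]
  have su' : Summable fun z => distWeight y z ^ (2 * p) * u z ^ 2 :=
    summable_of_support hu fun z hz => by simp [hz]
  have sv' : Summable fun z => distWeight x z ^ (2 * p) * v z ^ 2 :=
    summable_of_support hv fun z hz => by simp [hz]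
  have suv : Summable fun z => |u z| * |v z| := summable_of_support hu fun z hz => by simp [hz]
  have hF0 : 0 < R ^ (-(d / 2 : ℝ)) := by positivity
  generalize R ^ (-(d / 2 : ℝ)) = F at *
  have h2p : (1 : ℝ) ≤ 2 ^ p := one_le_pow₀ one_le_two
  have hon : ∑' z, |u z| * |v z| ≤ D * F := by
    calc ∑' z, |u z| * |v z| ≤ ∑' z, (1 / 2 * u z ^ 2 + 1 / 2 * v z ^ 2) := by
          refine suv.tsum_le_tsum (fun z => ?_) ((su.mul_left _).add (sv.mul_left _))
          rw [← sq_abs (u z), ← sq_abs (v z)]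
          nlinarith [sq_nonneg (|u z| - |v z|)]
      _ = 1 / 2 * ∑' z, u z ^ 2 + 1 / 2 * ∑' z, v z ^ 2 := by
          rw [(su.mul_left _).tsum_add (sv.mul_left _), tsum_mul_left, tsum_mul_left]
      _ ≤ D * F := by linarith
  have hoff : distWeight y x ^ p * ∑' z, |u z| * |v z|
      ≤ 2 ^ p * 2 ^ p * (C₂ + D) * (R ^ p * F) := by
    have hRp : 0 < R ^ p := by positivity
    -- Young's inequality, balanced so that both terms have the order `R ^ (p - d / 2)`
    have amgm : ∀ s t w : ℝ, w ^ p * (|s| * |t|) ≤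
        1 / 2 * ((R ^ p)⁻¹ * (w ^ (2 * p) * s ^ 2) + R ^ p * t ^ 2) := fun s t w => by
      have h := mul_nonneg (inv_pos.2 hRp).le (sq_nonneg (w ^ p * |s| - R ^ p * |t|))
      have e : (R ^ p)⁻¹ * (w ^ p * |s| - R ^ p * |t|) ^ 2
          = (R ^ p)⁻¹ * (w ^ (2 * p) * s ^ 2) + R ^ p * t ^ 2 - 2 * (w ^ p * (|s| * |t|)) := by
        rw [← sq_abs s, ← sq_abs t, mul_comm 2 p, pow_mul]
        field_simp
        ring
      linarith
    have point : ∀ z, distWeight y x ^ p * (|u z| * |v z|) ≤ 2 ^ p * 2 ^ p * (1 / 2) *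
        ((R ^ p)⁻¹ * (distWeight y z ^ (2 * p) * u z ^ 2) + R ^ p * v z ^ 2
        + ((R ^ p)⁻¹ * (distWeight x z ^ (2 * p) * v z ^ 2) + R ^ p * u z ^ 2)) := fun z => by
      have hs : distWeight y x ^ p ≤ 2 ^ p * 2 ^ p * (distWeight y z ^ p + distWeight x z ^ p) := by
        calc distWeight y x ^ p ≤ (2 * (distWeight y z + distWeight x z)) ^ p := by
              gcongr
              · exact (hpos y x).le
              · exact distWeight_le_add x y z
          _ ≤ (2 * (2 * max (distWeight y z) (distWeight x z))) ^ p := by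
              have := hpos y z
              have := hpos x z
              gcongr
              linarith [le_max_left (distWeight y z) (distWeight x z),
                le_max_right (distWeight y z) (distWeight x z)]
          _ = 2 ^ p * 2 ^ p * max (distWeight y z) (distWeight x z) ^ p := by
              rw [mul_pow, mul_pow, mul_assoc]
          _ ≤ _ := by
              gcongr
              have := pow_pos (hpos y z) p
              have := pow_pos (hpos x z) p
              rcases max_choice (distWeight y z) (distWeight x z) with h | h <;> rw [h] <;> linarith
      calc distWeight y x ^ p * (|u z| * |v z|)
          ≤ 2 ^ p * 2 ^ p * (distWeight y z ^ p + distWeight x z ^ p) * (|u z| * |v z|) := by gcongr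
        _ = 2 ^ p * 2 ^ p * (distWeight y z ^ p * (|u z| * |v z|)
              + distWeight x z ^ p * (|v z| * |u z|)) := by ring
        _ ≤ 2 ^ p * 2 ^ p * (1 / 2 * ((R ^ p)⁻¹ * (distWeight y z ^ (2 * p) * u z ^ 2)
              + R ^ p * v z ^ 2) + 1 / 2 * ((R ^ p)⁻¹ * (distWeight x z ^ (2 * p) * v z ^ 2)
              + R ^ p * u z ^ 2)) :=
            mul_le_mul_of_nonneg_left (add_le_add (amgm (u z) (v z) _) (amgm (v z) (u z) _))
              (by positivity)
        _ = _ := by ring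
    rw [← tsum_mul_left]
    have sA := (su'.mul_left (R ^ p)⁻¹).add (sv.mul_left (R ^ p))
    have sB := (sv'.mul_left (R ^ p)⁻¹).add (su.mul_left (R ^ p))
    calc _ ≤ ∑' z, 2 ^ p * 2 ^ p * (1 / 2) *
        ((R ^ p)⁻¹ * (distWeight y z ^ (2 * p) * u z ^ 2) + R ^ p * v z ^ 2
        + ((R ^ p)⁻¹ * (distWeight x z ^ (2 * p) * v z ^ 2) + R ^ p * u z ^ 2)) :=
          (suv.mul_left _).tsum_le_tsum point ((sA.add sB).mul_left _)
      _ = 2 ^ p * 2 ^ p * (1 / 2) *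
        ((R ^ p)⁻¹ * (∑' z, distWeight y z ^ (2 * p) * u z ^ 2) + R ^ p * (∑' z, v z ^ 2)
        + ((R ^ p)⁻¹ * (∑' z, distWeight x z ^ (2 * p) * v z ^ 2)
        + R ^ p * (∑' z, u z ^ 2))) := by
          rw [tsum_mul_left, sA.tsum_add sB, (su'.mul_left _).tsum_add (sv.mul_left _),
            (sv'.mul_left _).tsum_add (su.mul_left _)]
          simp only [tsum_mul_left]
      _ ≤ 2 ^ p * 2 ^ p * (1 / 2) *
        ((R ^ p)⁻¹ * (C₂ * (R ^ p * (R ^ p * F))) + R ^ p * (D * F)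
        + ((R ^ p)⁻¹ * (C₂ * (R ^ p * (R ^ p * F))) + R ^ p * (D * F))) := by gcongr
      _ = _ := by field_simp; ring
  rw [mul_min_of_nonneg _ _ hF0.le, mul_min_of_nonneg _ _ (by positivity)]
  refine le_min ?_ ?_
  · calc _ ≤ D * F := hon
      _ ≤ 1 * 1 * (C₂ + D) * (F * 1) := by nlinarith [mul_pos hC₂ hF0]
      _ ≤ _ := by gcongr
  · have hρ := pow_pos (hpos y x) p
    rw [div_pow, ← mul_div_assoc, ← mul_div_assoc, le_div_iff₀ hρ]
    linarith

end Pointwise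

/-! ### The random walk series of the Green function -/

section Resolvent

variable {d : ℕ} {α β Λ : ℝ} {a : (Fin d → ℤ) → Fin d → ℝ}

/-- The equation of the Green function in strong form. -/
theorem IsGreenAt.strong {T : ℝ} {y : Fin d → ℤ} {g : (Fin d → ℤ) → ℝ} (hg : IsGreenAt a T y g)
    (x : Fin d → ℤ) : T⁻¹ * g x + ellipticOp a g x = (Pi.single y 1 : (Fin d → ℤ) → ℝ) x := by
  have hfin := support_single x
  have h := hg.weak (Pi.single x 1)
    ((memℓp_two_iff _).2 (summable_of_support hfin fun z hz => by simp [hz]))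
  rw [← tsum_mul_ellipticOp' a hfin g, tsum_eq_single x (fun z hz => by simp [hz]),
    tsum_eq_single x (fun z hz => by simp [hz])] at h
  simp only [Pi.single_eq_same, mul_one, one_mul] at h
  rw [h, Pi.single_apply, Pi.single_apply]
  simp only [eq_comm]

theorem walkStep_linear (a : (Fin d → ℤ) → Fin d → ℝ) (Λ b c : ℝ) (u v : (Fin d → ℤ) → ℝ) :
    walkStep a Λ (b • u + c • v) = b • walkStep a Λ u + c • walkStep a Λ v := by
  funext x
  have h : ellipticOp a (b • u + c • v) x = b * ellipticOp a u x + c * ellipticOp a v x := by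
    simp only [ellipticOp, discreteGrad, Pi.add_apply, Pi.smul_apply, smul_eq_mul, Finset.mul_sum]
    rw [← Finset.sum_add_distrib]
    exact Finset.sum_congr rfl fun i _ => by ring
  simp only [walkStep, h, Pi.add_apply, Pi.smul_apply, smul_eq_mul]
  ring

theorem walkStep_iterate_linear (a : (Fin d → ℤ) → Fin d → ℝ) (Λ b c : ℝ)
    (u v : (Fin d → ℤ) → ℝ) (n : ℕ) : (walkStep a Λ)^[n] (b • u + c • v)
      = b • (walkStep a Λ)^[n] u + c • (walkStep a Λ)^[n] v := by
  induction n with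
  | zero => rfl
  | succ n ih => simp only [Function.iterate_succ_apply', ih, walkStep_linear]

/-- The Green function as a series over the number of steps of the walk, with a remainder. -/
theorem IsGreenAt.eq_sum_add {T : ℝ} (hT : 0 < T) (hΛ0 : 0 < Λ) {y : Fin d → ℤ}
    {g : (Fin d → ℤ) → ℝ} (hg : IsGreenAt a T y g) (n : ℕ) (x : Fin d → ℤ) :
    g x = (T⁻¹ + Λ)⁻¹ * ∑ j ∈ Finset.range n, (Λ / (T⁻¹ + Λ)) ^ j * walkKernel a Λ y j x
      + (Λ / (T⁻¹ + Λ)) ^ n * (walkStep a Λ)^[n] g x := by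
  have hT' : 0 < T⁻¹ + Λ := by positivity
  have hfix : g = (T⁻¹ + Λ)⁻¹ • (Pi.single y 1 : (Fin d → ℤ) → ℝ)
      + (Λ / (T⁻¹ + Λ)) • walkStep a Λ g := by
    funext x
    simp only [Pi.add_apply, Pi.smul_apply, smul_eq_mul, ← hg.strong x, walkStep]
    field_simp
    ring
  induction n with
  | zero => simp
  | succ n ih =>
    have h := walkStep_iterate_linear a Λ (T⁻¹ + Λ)⁻¹ (Λ / (T⁻¹ + Λ)) (Pi.single y 1)
      (walkStep a Λ g) n
    rw [← hfix] at h
    rw [ih, h, Finset.sum_range_succ, Function.iterate_succ_apply]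
    simp only [Pi.add_apply, Pi.smul_apply, smul_eq_mul, walkKernel]
    ring

/-- A bound for the partial sums of the random walk series bounds the Green function: the remainder
of the series vanishes, since the step contracts the sup norm. -/
theorem greenFunction_le_of_sum_le (hα : 0 < α) (ha : IsConductivity α β a) (hΛ0 : 0 < Λ)
    (hΛ : 4 * d * β ≤ Λ) {T : ℝ} (hT : 0 < T) {x y : Fin d → ℤ} {B : ℝ}
    (hB : ∀ n, ∑ j ∈ Finset.range n, (Λ / (T⁻¹ + Λ)) ^ j * |walkKernel a Λ y j x| ≤ B) :
    greenFunction a T x y ≤ B / Λ := by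
  have hg := isGreenAt_greenFunction hα ha hT y
  have hT' : 0 < T⁻¹ + Λ := by positivity
  obtain ⟨M, hM⟩ : ∃ M : ℝ, ∀ z, |greenFunction a T z y| ≤ M := by
    refine ⟨‖(⟨_, hg.memℓp⟩ : lp (fun _ : Fin d → ℤ => ℝ) 2)‖, fun z => ?_⟩
    exact lp.norm_apply_le_norm two_ne_zero (⟨_, hg.memℓp⟩ : lp (fun _ : Fin d → ℤ => ℝ) 2) z
  have hiter : ∀ n z, |(walkStep a Λ)^[n] (fun x => greenFunction a T x y) z| ≤ M := fun n => by
    induction n with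
    | zero => exact hM
    | succ n ih =>
      rw [Function.iterate_succ_apply']
      exact abs_walkStep_le_of_abs_le hα ha hΛ0 hΛ ih
  have hq0 : 0 ≤ Λ / (T⁻¹ + Λ) := by positivity
  have hq1 : Λ / (T⁻¹ + Λ) < 1 := by
    rw [div_lt_one hT']
    linarith [inv_pos.2 hT]
  have hB0 : 0 ≤ B := by simpa using hB 0
  have hle : ∀ n : ℕ, greenFunction a T x y ≤ B / Λ + (Λ / (T⁻¹ + Λ)) ^ n * M := fun n => by
    have h := hg.eq_sum_add (Λ := Λ) hT hΛ0 n x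
    rw [h]
    gcongr
    · calc (T⁻¹ + Λ)⁻¹ * ∑ j ∈ Finset.range n, (Λ / (T⁻¹ + Λ)) ^ j * walkKernel a Λ y j x
          ≤ (T⁻¹ + Λ)⁻¹ * B := by
            gcongr
            refine (Finset.sum_le_sum fun j _ => ?_).trans (hB n)
            gcongr
            exact le_abs_self _
        _ ≤ Λ⁻¹ * B := by
            gcongr
            linarith [inv_pos.2 hT]
        _ = B / Λ := by ring
    · exact (le_abs_self _).trans (hiter n x)
  have hlim := ((tendsto_pow_atTop_nhds_zero_of_lt_one hq0 hq1).mul_const M).const_add (B / Λ)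
  rw [zero_mul, add_zero] at hlim
  exact ge_of_tendsto' hlim hle

end Resolvent

/-! ### Sums over time -/

section Sums

theorem sum_rpow_Ico_le_integral (s : ℝ) (hs : 0 ≤ s) {m n : ℕ} (hm : 0 < m) (hmn : m ≤ n) :
    ∑ j ∈ Finset.Ico m n, ((j : ℝ) + 1) ^ (-s) ≤ ∫ x in (m : ℝ)..n, x ^ (-s) := by
  have h := AntitoneOn.sum_le_integral_Ico (f := fun x : ℝ => x ^ (-s)) hmn
    fun x hx y hy hxy => Real.rpow_le_rpow_of_nonpos
      ((by exact_mod_cast hm : (0 : ℝ) < m).trans_le hx.1) hxy (by linarith)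
  simpa using h

theorem half_le_floor {ρ : ℝ} (hρ : 1 ≤ ρ) : ρ / 2 ≤ (⌊ρ⌋₊ : ℝ) := by
  have h1 := Nat.lt_floor_add_one ρ
  have h2 : (1 : ℝ) ≤ ⌊ρ⌋₊ := by exact_mod_cast Nat.floor_pos.2 hρ
  linarith

theorem sum_rpow_tail_le {s ρ : ℝ} (hs : 1 < s) (hρ : 1 ≤ ρ) (n : ℕ) :
    ∑ j ∈ Finset.range n with ρ < ((j : ℕ) : ℝ) + 1, ((j : ℝ) + 1) ^ (-s)
      ≤ 2 ^ (s - 1) / (s - 1) * ρ ^ (1 - s) := by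
  have hm : 0 < ⌊ρ⌋₊ := Nat.floor_pos.2 hρ
  have hm' : (0 : ℝ) < ⌊ρ⌋₊ := by exact_mod_cast hm
  have hs0 : 0 < s - 1 := by linarith
  have hsub : (Finset.range n).filter (fun j : ℕ => ρ < (j : ℝ) + 1) ⊆ Finset.Ico ⌊ρ⌋₊ n := by
    intro j hj
    rw [Finset.mem_filter, Finset.mem_range] at hj
    rw [Finset.mem_Ico]
    refine ⟨Nat.lt_succ_iff.1 ((Nat.floor_lt (by linarith)).2 ?_), hj.1⟩
    push_cast
    exact hj.2
  refine (Finset.sum_le_sum_of_subset_of_nonneg hsub fun j _ _ => by positivity).trans ?_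
  rcases le_total ⌊ρ⌋₊ n with hmn | hmn
  · refine (sum_rpow_Ico_le_integral s (by linarith) hm hmn).trans ?_
    have h0 : (0 : ℝ) ∉ Set.uIcc (⌊ρ⌋₊ : ℝ) n := by
      rw [Set.uIcc_of_le (by exact_mod_cast hmn)]
      exact fun h => hm'.not_ge h.1
    rw [integral_rpow (Or.inr ⟨by linarith, h0⟩)]
    have hn : 0 ≤ (n : ℝ) ^ (1 - s) := by positivity
    have hfl : (⌊ρ⌋₊ : ℝ) ^ (1 - s) ≤ 2 ^ (s - 1) * ρ ^ (1 - s) := by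
      calc (⌊ρ⌋₊ : ℝ) ^ (1 - s) ≤ (ρ / 2) ^ (1 - s) :=
            Real.rpow_le_rpow_of_nonpos (by linarith) (half_le_floor hρ) (by linarith)
        _ = 2 ^ (s - 1) * ρ ^ (1 - s) := by
            rw [Real.div_rpow (by linarith) two_pos.le, div_eq_mul_inv, ← Real.rpow_neg two_pos.le,
              neg_sub, mul_comm]
    have e : ((n : ℝ) ^ (-s + 1) - (⌊ρ⌋₊ : ℝ) ^ (-s + 1)) / (-s + 1)
        = ((⌊ρ⌋₊ : ℝ) ^ (1 - s) - (n : ℝ) ^ (1 - s)) / (s - 1) := by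
      rw [neg_add_eq_sub, ← neg_sub s 1, div_neg, ← neg_div, neg_sub]
    rw [e, div_mul_eq_mul_div]
    gcongr
    linarith
  · rw [Finset.Ico_eq_empty_of_le hmn, Finset.sum_empty]
    positivity

theorem sum_rpow_head_le {s ρ : ℝ} {p : ℕ} (hsp : s ≤ p) (hρ : 1 ≤ ρ) (n : ℕ) :
    ∑ j ∈ Finset.range n with ¬ρ < ((j : ℕ) : ℝ) + 1,
      ((j : ℝ) + 1) ^ (-s) * (((j : ℝ) + 1) / ρ) ^ p ≤ ρ ^ (1 - s) := by
  have hρ0 : 0 < ρ := by linarith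
  have hsub : (Finset.range n).filter (fun j : ℕ => ¬ρ < (j : ℝ) + 1) ⊆ Finset.range ⌊ρ⌋₊ := by
    intro j hj
    rw [Finset.mem_filter, not_lt] at hj
    rw [Finset.mem_range, ← Nat.succ_le_iff]
    exact Nat.le_floor (by push_cast; exact hj.2)
  have hcard : (((Finset.range n).filter (fun j : ℕ => ¬ρ < (j : ℝ) + 1)).card : ℝ) ≤ ρ := by
    refine le_trans ?_ (Nat.floor_le hρ0.le)
    exact_mod_cast (Finset.card_le_card hsub).trans (Finset.card_range _).le
  calc _ ≤ ∑ j ∈ Finset.range n with ¬ρ < ((j : ℕ) : ℝ) + 1, ρ ^ (-s) := by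
        refine Finset.sum_le_sum fun j hj => ?_
        rw [Finset.mem_filter, not_lt] at hj
        have hj0 : (0 : ℝ) < (j : ℝ) + 1 := by positivity
        have ht : 0 < ((j : ℝ) + 1) / ρ := by positivity
        have e : ((j : ℝ) + 1) ^ (-s) = ρ ^ (-s) * (((j : ℝ) + 1) / ρ) ^ (-s) := by
          rw [← Real.mul_rpow hρ0.le ht.le, mul_div_cancel₀ _ hρ0.ne']
        rw [e, mul_assoc, ← Real.rpow_natCast (((j : ℝ) + 1) / ρ), ← Real.rpow_add ht]
        refine mul_le_of_le_one_right (by positivity) (Real.rpow_le_one ht.le ?_ (by linarith))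
        rw [div_le_one hρ0]
        exact hj.2
    _ ≤ ρ * ρ ^ (-s) := by
        rw [Finset.sum_const, nsmul_eq_mul]
        gcongr
    _ = ρ ^ (1 - s) := by
        rw [sub_eq_add_neg, Real.rpow_add hρ0, Real.rpow_one]

/-- Summing the heat kernel bound over time: the times up to `ρ` and the times beyond `ρ` both
contribute the order `ρ ^ (1 - s)`. -/
theorem sum_rpow_mul_min_le {s ρ : ℝ} {p : ℕ} (hs : 1 < s) (hsp : s ≤ p) (hρ : 1 ≤ ρ) (n : ℕ) :
    ∑ j ∈ Finset.range n, ((j : ℝ) + 1) ^ (-s) * min 1 ((((j : ℝ) + 1) / ρ) ^ p)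
      ≤ (2 ^ (s - 1) / (s - 1) + 1) * ρ ^ (1 - s) := by
  rw [← Finset.sum_filter_add_sum_filter_not _ fun j : ℕ => ρ < (j : ℝ) + 1, add_mul, one_mul]
  refine add_le_add (le_trans ?_ (sum_rpow_tail_le hs hρ n))
    (le_trans ?_ (sum_rpow_head_le hsp hρ n))
  · exact Finset.sum_le_sum fun j _ => mul_le_of_le_one_right (by positivity) (min_le_left _ _)
  · gcongr
    exact min_le_right _ _

/-- The critical case `s = 1`: the sum is `O(1)` up to time `ρ` and, by the geometric factor, after
time `B`; in between it is a harmonic sum. -/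
theorem sum_geometric_mul_min_le {q ρ B : ℝ} {p : ℕ} (hq0 : 0 ≤ q) (hq1 : q < 1)
    (hqB : (1 - q)⁻¹ ≤ B) (hp : 1 ≤ p) (hρ : 1 ≤ ρ) (hρB : ρ ≤ B) (n : ℕ) :
    ∑ j ∈ Finset.range n, q ^ j * (((j : ℝ) + 1) ^ (-1 : ℝ) * min 1 ((((j : ℝ) + 1) / ρ) ^ p))
      ≤ 2 + Real.log (2 * B / ρ) := by
  have hm : 0 < ⌊ρ⌋₊ := Nat.floor_pos.2 hρ
  have hm' : (0 : ℝ) < ⌊ρ⌋₊ := by exact_mod_cast hm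
  have hB0 : 0 < B := by linarith
  have hρ0 : 0 < ρ := by linarith
  have hmM : ⌊ρ⌋₊ ≤ ⌊B⌋₊ := Nat.floor_le_floor hρB
  have head : ∑ j ∈ Finset.range n with ¬ρ < ((j : ℕ) : ℝ) + 1,
      q ^ j * (((j : ℝ) + 1) ^ (-1 : ℝ) * min 1 ((((j : ℝ) + 1) / ρ) ^ p)) ≤ 1 := by
    have h := sum_rpow_head_le (s := 1) (by exact_mod_cast hp) hρ n
    rw [sub_self, Real.rpow_zero] at h
    refine (Finset.sum_le_sum fun j _ => ?_).trans h
    refine (mul_le_of_le_one_left (by positivity) (pow_le_one₀ hq0 hq1.le)).trans ?_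
    gcongr
    exact min_le_right _ _
  have geom : ∑ j ∈ Finset.range n, q ^ j * B⁻¹ ≤ 1 := by
    rw [← Finset.sum_mul, ← div_eq_mul_inv, div_le_one hB0]
    refine le_trans ?_ hqB
    rw [← tsum_geometric_of_lt_one hq0 hq1]
    exact (summable_geometric_of_lt_one hq0 hq1).sum_le_tsum _ fun j _ => pow_nonneg hq0 j
  have hlog : ∑ j ∈ Finset.Ico ⌊ρ⌋₊ ⌊B⌋₊, ((j : ℝ) + 1) ^ (-1 : ℝ) ≤ Real.log (2 * B / ρ) := by
    refine (sum_rpow_Ico_le_integral 1 zero_le_one hm hmM).trans ?_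
    simp only [Real.rpow_neg_one]
    have hM' : (0 : ℝ) < ⌊B⌋₊ := hm'.trans_le (by exact_mod_cast hmM)
    rw [integral_inv_of_pos hm' hM']
    refine Real.log_le_log (by positivity) ?_
    calc (⌊B⌋₊ : ℝ) / ⌊ρ⌋₊ ≤ B / (ρ / 2) := by
          gcongr
          · exact Nat.floor_le hB0.le
          · exact half_le_floor hρ
      _ = 2 * B / ρ := by field_simp
  have tail : ∑ j ∈ Finset.range n with ρ < ((j : ℕ) : ℝ) + 1,
      q ^ j * (((j : ℝ) + 1) ^ (-1 : ℝ) * min 1 ((((j : ℝ) + 1) / ρ) ^ p))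
      ≤ 1 + Real.log (2 * B / ρ) := by
    calc _ ≤ ∑ j ∈ Finset.range n with ρ < ((j : ℕ) : ℝ) + 1,
          (q ^ j * B⁻¹ + if j ∈ Finset.Ico ⌊ρ⌋₊ ⌊B⌋₊ then ((j : ℝ) + 1) ^ (-1 : ℝ) else 0) := by
          refine Finset.sum_le_sum fun j hj => ?_
          rw [Finset.mem_filter] at hj
          have h1 : q ^ j * (((j : ℝ) + 1) ^ (-1 : ℝ) * min 1 ((((j : ℝ) + 1) / ρ) ^ p))
              ≤ q ^ j * ((j : ℝ) + 1) ^ (-1 : ℝ) := by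
            gcongr
            exact mul_le_of_le_one_right (by positivity) (min_le_left _ _)
          refine h1.trans ?_
          have hqB0 : 0 ≤ q ^ j * B⁻¹ := by positivity
          have hfloor : ⌊ρ⌋₊ ≤ j := by
            refine Nat.lt_succ_iff.1 ((Nat.floor_lt hρ0.le).2 ?_)
            push_cast
            exact hj.2
          by_cases hjB : j < ⌊B⌋₊
          · rw [if_pos (Finset.mem_Ico.2 ⟨hfloor, hjB⟩)]
            have := mul_le_of_le_one_left (by positivity : 0 ≤ ((j : ℝ) + 1) ^ (-1 : ℝ))
              (pow_le_one₀ hq0 hq1.le : q ^ j ≤ 1)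
            linarith
          · rw [if_neg fun h => hjB (Finset.mem_Ico.1 h).2, add_zero, Real.rpow_neg_one]
            gcongr
            have h2 : (⌊B⌋₊ : ℝ) ≤ j := by exact_mod_cast not_lt.1 hjB
            linarith [Nat.lt_floor_add_one B]
      _ ≤ ∑ j ∈ Finset.range n, q ^ j * B⁻¹
          + ∑ j ∈ Finset.Ico ⌊ρ⌋₊ ⌊B⌋₊, ((j : ℝ) + 1) ^ (-1 : ℝ) := by
          rw [Finset.sum_add_distrib]
          refine add_le_add (Finset.sum_le_sum_of_subset_of_nonneg (Finset.filter_subset _ _)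
            fun j _ _ => by positivity) ?_
          rw [← Finset.sum_filter]
          exact Finset.sum_le_sum_of_subset_of_nonneg
            (fun j hj => (Finset.mem_filter.1 hj).2) fun j _ _ => by positivity
      _ ≤ _ := add_le_add geom hlog
  rw [← Finset.sum_filter_add_sum_filter_not _ fun j : ℕ => ρ < (j : ℝ) + 1]
  linarith

/-- The killing factor decays faster than any power of `j / T`. -/
theorem geometric_le_rpow {Λ T e : ℝ} (hΛ : 0 < Λ) (hT : 0 < T) (he : 0 ≤ e) (j : ℕ) :
    (Λ / (T⁻¹ + Λ)) ^ j
      ≤ Real.exp 1 * e ^ e * ((1 + Λ * T) ^ e * ((j : ℝ) + 1) ^ (-e)) := by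
  obtain ⟨S, hS⟩ : ∃ S, S = 1 + Λ * T := ⟨_, rfl⟩
  have hS1 : 1 ≤ S := by rw [hS]; linarith [mul_pos hΛ hT]
  have hS0 : 0 < S := by linarith
  have hj : (0 : ℝ) < (j : ℝ) + 1 := by positivity
  have hq : Λ / (T⁻¹ + Λ) = 1 - 1 / S := by rw [hS]; field_simp; ring
  have hq0 : 0 ≤ Λ / (T⁻¹ + Λ) := by positivity
  have h1 : (Λ / (T⁻¹ + Λ)) ^ j ≤ Real.exp 1 * Real.exp (-(((j : ℝ) + 1) / S)) := by
    calc (Λ / (T⁻¹ + Λ)) ^ j ≤ Real.exp (-(1 / S)) ^ j := by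
          gcongr
          rw [hq]
          linarith [Real.add_one_le_exp (-(1 / S))]
      _ = Real.exp (1 / S - ((j : ℝ) + 1) / S) := by
          rw [← Real.exp_nat_mul]
          congr 1
          ring
      _ ≤ Real.exp (1 - ((j : ℝ) + 1) / S) := by
          gcongr
          exact (div_le_one hS0).2 hS1
      _ = _ := by rw [sub_eq_add_neg, Real.exp_add]
  have h2 : ∀ t : ℝ, 0 < t → Real.exp (-t) ≤ e ^ e * t ^ (-e) := fun t ht => by
    rcases he.eq_or_lt with rfl | he
    · simpa using ht.le
    · have h : (t / e) ^ e ≤ Real.exp t := by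
        calc (t / e) ^ e ≤ Real.exp (t / e) ^ e := by
              gcongr
              linarith [Real.add_one_le_exp (t / e)]
          _ = Real.exp t := by rw [← Real.exp_mul, div_mul_cancel₀ _ he.ne']
      rw [Real.div_rpow ht.le he.le, div_le_iff₀ (by positivity)] at h
      rw [Real.exp_neg, Real.rpow_neg ht.le, ← div_eq_mul_inv, le_div_iff₀ (by positivity),
        inv_mul_le_iff₀ (Real.exp_pos t)]
      exact h
  calc _ ≤ Real.exp 1 * (e ^ e * (((j : ℝ) + 1) / S) ^ (-e)) := by
        refine h1.trans ?_
        gcongr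
        exact h2 _ (by positivity)
    _ = _ := by
        rw [← hS, Real.div_rpow hj.le hS0.le, Real.rpow_neg hS0.le, div_inv_eq_mul]
        ring

end Sums

/-! ### Bounds for the Green function -/

section Green

variable {d : ℕ} {α β : ℝ}

theorem latticeDist_nonneg (x y : Fin d → ℤ) : 0 ≤ latticeDist x y := Real.sqrt_nonneg _

theorem sq_one_add_latticeDist_le (x y : Fin d → ℤ) :
    (1 + latticeDist x y) ^ 2 ≤ 2 * distWeight y x := by
  rw [distWeight_eq]
  nlinarith [sq_nonneg (1 - latticeDist x y)]

/-- The Green function bound in which a factor `(√T / |x - y|) ^ (2 e)` is gained from the mass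
term. It covers every case but the logarithmic one `d = 2`, `e = 0`. -/
theorem exists_greenFunction_le (hd : 2 ≤ d) (hα : 0 < α) (hαβ : α ≤ β) {e : ℝ} (he : 0 ≤ e)
    (hde : 2 < d + 2 * e) {T₀ : ℝ} (hT₀ : 0 < T₀) : ∃ C : ℝ, 0 < C ∧
      ∀ a : (Fin d → ℤ) → Fin d → ℝ, IsConductivity α β a → ∀ T : ℝ, T₀ ≤ T →
        ∀ x y : Fin d → ℤ, greenFunction a T x y
          ≤ C * (T ^ e * (1 + latticeDist x y) ^ (2 - (d : ℝ) - 2 * e)) := by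
  have hd0 : (2 : ℝ) ≤ d := by exact_mod_cast hd
  have hβ : 0 < β := hα.trans_le hαβ
  obtain ⟨Λ, hΛ⟩ : ∃ Λ : ℝ, Λ = 4 * d * β := ⟨_, rfl⟩
  have hΛ0 : 0 < Λ := by rw [hΛ]; positivity
  obtain ⟨s, hs⟩ : ∃ s : ℝ, s = d / 2 + e := ⟨_, rfl⟩
  have hs1 : 1 < s := by rw [hs]; linarith
  obtain ⟨p, hp⟩ := exists_nat_ge s
  have hdp : d ≤ 2 * p := by
    have : (d : ℝ) ≤ 2 * p := by linarith
    exact_mod_cast this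
  obtain ⟨C, hC, h⟩ := exists_abs_walkKernel_le hd hα hΛ0 hΛ.ge hdp
  obtain ⟨A, hA⟩ : ∃ A : ℝ, A = 2 ^ (s - 1) / (s - 1) + 1 := ⟨_, rfl⟩
  have hA0 : 0 < A := by
    have : 0 < s - 1 := by linarith
    rw [hA]; positivity
  have hee : 0 < e ^ e := by
    rcases he.eq_or_lt with rfl | he
    · simp
    · positivity
  refine ⟨Real.exp 1 * e ^ e * C * A * (T₀⁻¹ + Λ) ^ e * 2 ^ (s - 1) / Λ, by positivity,
    fun a ha T hT x y => ?_⟩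
  have hT0 : 0 < T := hT₀.trans_le hT
  have hr := latticeDist_nonneg x y
  have hρ1 := one_le_distWeight y x
  have hρ0 : 0 < distWeight y x := by linarith
  have hsum : ∀ n, ∑ j ∈ Finset.range n, (Λ / (T⁻¹ + Λ)) ^ j * |walkKernel a Λ y j x|
      ≤ Real.exp 1 * e ^ e * (1 + Λ * T) ^ e * C * (A * distWeight y x ^ (1 - s)) := fun n => by
    rw [hA]
    refine le_trans ?_ (mul_le_mul_of_nonneg_left (sum_rpow_mul_min_le hs1 hp hρ1 n)
      (by positivity))
    rw [Finset.mul_sum]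
    refine Finset.sum_le_sum fun j _ => ?_
    have hj : (0 : ℝ) < (j : ℝ) + 1 := by positivity
    calc _ ≤ (Real.exp 1 * e ^ e * ((1 + Λ * T) ^ e * ((j : ℝ) + 1) ^ (-e))) *
          (C * (((j : ℝ) + 1) ^ (-(d / 2 : ℝ)) *
          min 1 ((((j : ℝ) + 1) / distWeight y x) ^ p))) :=
          mul_le_mul (geometric_le_rpow hΛ0 hT0 he j) (h a ha x y j) (abs_nonneg _) (by positivity)
      _ = Real.exp 1 * e ^ e * (1 + Λ * T) ^ e * C *
          ((((j : ℝ) + 1) ^ (-(d / 2 : ℝ)) * ((j : ℝ) + 1) ^ (-e)) *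
          min 1 ((((j : ℝ) + 1) / distWeight y x) ^ p)) := by ring
      _ = _ := by
          rw [← Real.rpow_add hj, hs, neg_add]
  have hg := greenFunction_le_of_sum_le hα ha hΛ0 hΛ.ge hT0 hsum
  have hTe : (1 + Λ * T) ^ e ≤ (T₀⁻¹ + Λ) ^ e * T ^ e := by
    rw [← Real.mul_rpow (by positivity) hT0.le, add_mul]
    have : 1 ≤ T₀⁻¹ * T := by rwa [← div_eq_inv_mul, one_le_div hT₀]
    gcongr
  have hρs : distWeight y x ^ (1 - s)
      ≤ 2 ^ (s - 1) * (1 + latticeDist x y) ^ (2 - (d : ℝ) - 2 * e) := by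
    calc distWeight y x ^ (1 - s) ≤ ((1 + latticeDist x y) ^ 2 / 2) ^ (1 - s) :=
          Real.rpow_le_rpow_of_nonpos (by positivity)
            (by linarith [sq_one_add_latticeDist_le x y]) (by linarith)
      _ = _ := by
          rw [Real.div_rpow (by positivity) two_pos.le, div_eq_mul_inv, ← Real.rpow_neg two_pos.le,
            neg_sub, mul_comm, ← Real.rpow_natCast, ← Real.rpow_mul (by positivity), hs]
          congr 2
          push_cast
          ring
  refine hg.trans ?_
  rw [div_mul_eq_mul_div]
  refine div_le_div_of_nonneg_right ?_ hΛ0.le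
  calc _ ≤ Real.exp 1 * e ^ e * ((T₀⁻¹ + Λ) ^ e * T ^ e) * C *
        (A * (2 ^ (s - 1) * (1 + latticeDist x y) ^ (2 - (d : ℝ) - 2 * e))) := by gcongr
    _ = _ := by ring

/-- The logarithmic bound in two dimensions. The additive constants of the heat kernel sum are
absorbed because the logarithm is at least `log (1 / δ) > 0`. -/
theorem exists_greenFunction_le_log (hα : 0 < α) (hαβ : α ≤ β) {δ : ℝ} (hδ : 0 < δ)
    (hδ1 : δ < 1) : ∃ C : ℝ, ∀ a : (Fin 2 → ℤ) → Fin 2 → ℝ, IsConductivity α β a → ∀ T : ℝ, 0 < T →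
      ∀ x y : Fin 2 → ℤ, 1 + latticeDist x y ≤ δ * √T →
        greenFunction a T x y ≤ C * Real.log (√T / (1 + latticeDist x y)) := by
  have hβ : 0 < β := hα.trans_le hαβ
  obtain ⟨Λ, hΛ⟩ : ∃ Λ : ℝ, Λ = 4 * (2 : ℕ) * β := ⟨_, rfl⟩
  have hΛ0 : 0 < Λ := by rw [hΛ]; positivity
  obtain ⟨C, hC, h⟩ := exists_abs_walkKernel_le le_rfl hα hΛ0 hΛ.ge (p := 1) le_rfl
  obtain ⟨b, hb⟩ : ∃ b : ℝ, b = Real.log δ⁻¹ := ⟨_, rfl⟩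
  have hb0 : 0 < b := by rw [hb]; exact Real.log_pos ((one_lt_inv₀ hδ).2 hδ1)
  have hc0 : 0 < 2 + Real.log (4 * (1 + Λ)) := by
    have := Real.log_nonneg (by linarith : 1 ≤ 4 * (1 + Λ))
    linarith
  refine ⟨C * ((2 + Real.log (4 * (1 + Λ))) / b + 2) / Λ, fun a ha T hT x y hxy => ?_⟩
  have hr := latticeDist_nonneg x y
  have hR0 : 0 < 1 + latticeDist x y := by linarith
  have hρ1 := one_le_distWeight y x
  have hTR : 1 + latticeDist x y ≤ √T := by nlinarith [Real.sqrt_nonneg T]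
  have hT1 : (1 + latticeDist x y) ^ 2 ≤ T := by
    calc (1 + latticeDist x y) ^ 2 ≤ √T ^ 2 := by gcongr
      _ = T := Real.sq_sqrt hT.le
  have hρT : distWeight y x ≤ T := by rw [distWeight_eq]; nlinarith
  have hq1 : Λ / (T⁻¹ + Λ) < 1 := by
    rw [div_lt_one (by positivity)]
    linarith [inv_pos.2 hT]
  have hqB : (1 - Λ / (T⁻¹ + Λ))⁻¹ ≤ (1 + Λ) * T := by
    have e : (1 - Λ / (T⁻¹ + Λ))⁻¹ = 1 + Λ * T := by
      have : 1 - Λ / (T⁻¹ + Λ) = (1 + Λ * T)⁻¹ := by field_simp; ring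
      rw [this, inv_inv]
    rw [e]
    linarith
  have hsum : ∀ n, ∑ j ∈ Finset.range n, (Λ / (T⁻¹ + Λ)) ^ j * |walkKernel a Λ y j x|
      ≤ C * (2 + Real.log (2 * ((1 + Λ) * T) / distWeight y x)) := fun n => by
    refine le_trans ?_ (mul_le_mul_of_nonneg_left (sum_geometric_mul_min_le (p := 1)
      (by positivity) hq1 hqB le_rfl hρ1 (hρT.trans (by nlinarith)) n) hC.le)
    rw [Finset.mul_sum]
    refine Finset.sum_le_sum fun j _ => ?_
    rw [mul_left_comm]
    refine mul_le_mul_of_nonneg_left ?_ (by positivity)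
    refine (h a ha x y j).trans_eq ?_
    norm_num
  refine (greenFunction_le_of_sum_le hα ha hΛ0 hΛ.ge hT hsum).trans ?_
  obtain ⟨ℓ, hℓ⟩ : ∃ ℓ, ℓ = Real.log (√T / (1 + latticeDist x y)) := ⟨_, rfl⟩
  have hℓb : b ≤ ℓ := by
    rw [hb, hℓ]
    refine Real.log_le_log (inv_pos.2 hδ) ?_
    rw [le_div_iff₀ hR0, inv_mul_le_iff₀ hδ]
    exact hxy
  have hlog : Real.log (2 * ((1 + Λ) * T) / distWeight y x)
      ≤ Real.log (4 * (1 + Λ)) + 2 * ℓ := by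
    have e : Real.log (4 * (1 + Λ)) + 2 * ℓ
        = Real.log (4 * (1 + Λ) * (√T / (1 + latticeDist x y)) ^ 2) := by
      rw [Real.log_mul (x := 4 * (1 + Λ)) (by positivity) (by positivity), Real.log_pow, hℓ]
      norm_num
    rw [e, div_pow, Real.sq_sqrt hT.le]
    refine Real.log_le_log (by positivity) ?_
    rw [← mul_div_assoc, div_le_div_iff₀ (by linarith) (by positivity)]
    calc 2 * ((1 + Λ) * T) * (1 + latticeDist x y) ^ 2
        ≤ 2 * ((1 + Λ) * T) * (2 * distWeight y x) := by
          gcongr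
          exact sq_one_add_latticeDist_le x y
      _ = _ := by ring
  rw [← hℓ, div_mul_eq_mul_div, mul_assoc C]
  refine div_le_div_of_nonneg_right (mul_le_mul_of_nonneg_left ?_ hC.le) hΛ0.le
  have h1 : 2 + Real.log (4 * (1 + Λ)) ≤ (2 + Real.log (4 * (1 + Λ))) / b * ℓ := by
    rw [div_mul_eq_mul_div, le_div_iff₀ hb0]
    gcongr
  rw [add_mul _ _ ℓ]
  linarith

end Green

theorem lemma4 (d : ℕ) (hd : 2 ≤ d) (α β : ℝ) (hα : 0 < α) (hαβ : α ≤ β) :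
    (2 < d →
      ∀ k : ℝ, 0 < k → ∀ T₀ : ℝ, 0 < T₀ → ∃ C : ℝ,
        ∀ a : (Fin d → ℤ) → Fin d → ℝ, IsConductivity α β a →
        ∀ T : ℝ, T₀ ≤ T → ∀ x y : Fin d → ℤ,
          greenFunction a T x y ≤
            C * ((1 + latticeDist x y) ^ (2 - (d : ℝ)) * decayFactor k (latticeDist x y / √T))) ∧
    (d = 2 →
      (∀ δ : ℝ, 0 < δ → δ < 1 → ∃ C : ℝ,
        ∀ a : (Fin d → ℤ) → Fin d → ℝ, IsConductivity α β a →
        ∀ T : ℝ, 0 < T → ∀ x y : Fin d → ℤ, 1 + latticeDist x y ≤ δ * √T →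
          greenFunction a T x y ≤ C * Real.log (√T / (1 + latticeDist x y))) ∧
      (∀ k : ℝ, 0 < k → ∀ c : ℝ, 0 < c → ∀ T₀ : ℝ, 0 < T₀ → ∃ C : ℝ,
        ∀ a : (Fin d → ℤ) → Fin d → ℝ, IsConductivity α β a →
        ∀ T : ℝ, T₀ ≤ T → ∀ x y : Fin d → ℤ, c * √T ≤ latticeDist x y →
          greenFunction a T x y ≤ C * (latticeDist x y / √T) ^ (-k))) := by
  -- the gain `T ^ (k / 2) (1 + r) ^ (-k)` is at most `(r / √T) ^ (-k)`
  have gain : ∀ k T r : ℝ, 0 < k → 0 < T → 0 < r →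
      T ^ (k / 2) * (1 + r) ^ (2 - (d : ℝ) - 2 * (k / 2))
        ≤ (1 + r) ^ (2 - (d : ℝ)) * (r / √T) ^ (-k) := fun k T r hk hT hr => by
    have h1 : (1 + r) ^ (-k) ≤ r ^ (-k) :=
      Real.rpow_le_rpow_of_nonpos hr (by linarith) (by linarith)
    have h2 : (r / √T) ^ (-k) = T ^ (k / 2) * r ^ (-k) := by
      rw [Real.div_rpow hr.le (Real.sqrt_nonneg T), Real.sqrt_eq_rpow, ← Real.rpow_mul hT.le,
        div_eq_mul_inv, ← Real.rpow_neg hT.le, mul_comm]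
      congr 2
      ring
    have h3 : (1 + r) ^ (2 - (d : ℝ) - 2 * (k / 2)) = (1 + r) ^ (2 - (d : ℝ)) * (1 + r) ^ (-k) := by
      rw [← Real.rpow_add (by linarith)]
      congr 1
      ring
    rw [h2, h3, mul_left_comm]
    gcongr
  have hdR : (2 : ℝ) ≤ d := by exact_mod_cast hd
  refine ⟨fun hd2 k hk T₀ hT₀ => ?_, fun hd2 => ⟨fun δ hδ hδ1 => ?_, fun k hk c hc T₀ hT₀ => ?_⟩⟩
  · have hd2' : (2 : ℝ) < d := by exact_mod_cast hd2
    obtain ⟨C₁, hC₁, h₁⟩ := exists_greenFunction_le hd hα hαβ le_rfl (by linarith) hT₀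
    obtain ⟨C₂, hC₂, h₂⟩ := exists_greenFunction_le hd hα hαβ (e := k / 2) (by linarith)
      (by linarith) hT₀
    refine ⟨C₁ + C₂, fun a ha T hT x y => ?_⟩
    have hT0 := hT₀.trans_le hT
    have hr := latticeDist_nonneg x y
    have g1 := h₁ a ha T hT x y
    have g2 := h₂ a ha T hT x y
    rw [Real.rpow_zero, one_mul, mul_zero, sub_zero] at g1
    have hX : 0 < (1 + latticeDist x y) ^ (2 - (d : ℝ)) := by positivity
    have large : greenFunction a T x y ≤ (C₁ + C₂) * (1 + latticeDist x y) ^ (2 - (d : ℝ)) := by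
      nlinarith [mul_pos hC₂ hX]
    rw [decayFactor]
    split_ifs with h0
    · rwa [mul_one]
    · have hr0 : 0 < latticeDist x y :=
        hr.lt_of_ne fun h => h0 (by rw [← h, zero_div])
      rw [mul_min_of_nonneg _ _ hX.le, mul_min_of_nonneg _ _ (by positivity), mul_one]
      refine le_min large ?_
      have h := gain k T _ hk hT0 hr0
      calc greenFunction a T x y ≤ C₂ * _ := g2.trans (mul_le_mul_of_nonneg_left h hC₂.le)
        _ ≤ _ := by
          gcongr
          linarith
  · subst hd2
    exact exists_greenFunction_le_log hα hαβ hδ hδ1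
  · obtain ⟨C, hC, h⟩ := exists_greenFunction_le hd hα hαβ (e := k / 2) (by linarith)
      (by linarith) hT₀
    refine ⟨C, fun a ha T hT x y hxy => (h a ha T hT x y).trans ?_⟩
    have hT0 := hT₀.trans_le hT
    have hr0 : 0 < latticeDist x y := lt_of_lt_of_le (by positivity) hxy
    refine mul_le_mul_of_nonneg_left ((gain k T _ hk hT0 hr0).trans_eq ?_) hC.le
    have hd2' : 2 - (d : ℝ) = 0 := by rw [hd2, Nat.cast_ofNat, sub_self]
    rw [hd2', Real.rpow_zero, one_mul]
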